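/- **Setting.** Fix $s_0\in\mathbb R$ (the threshold) and let $X$ be the two-sheeted Riemann surface of $\sqrt{s-s_0}$, with coordinate $w$, $w^2=s-s_0$; the first sheet is $\operatorname{Im}w>0$, the second sheet is $\operatorname{Im}w<0$, and they are joined along the cut $(s_0,\infty)$, so that the upper edge of the cut on the first sheet is the lower edge of the cut on the second sheet. Let $S$ (a partial S-matrix $S_j$ for fixed $j$) be a meromorphic function on $X$ that has no poles on the first sheet except possibly at real $s<s_0$, and that in the closed lower half of the second sheet (including the real axis $s<s_0$, the cut edge and the branch point) is analytic except for first-order poles at $N$ distinct points $s_{R_1},\dots,s_{R_N}$ with $\operatorname{Im}s_{R_i}<0$; there $S_{II}(s)=\frac{R^{(i)}}{s-s_{R_i}}+(\text{analytic})$ with $R^{(i)}\ne0$, where $S_{II}$ denotes $S$ on the closed lower half of the second sheet. Assume that there is a polynomial $P$ with $|S_{II}(s)|\le|P(s)|$ for all large $|s|$, $\operatorname{Im}s\le0$. Let $K$ be a complex Hilbert space, with inner product antilinear in the first argument (the labels other than $s$, such as $\hat{\boldsymbol p},j_3$; $K=\mathbb C$ if these are suppressed). Let $\mathcal H^2_\pm$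 be the $K$-valued Hardy classes of the upper/lower half-plane and $\tilde{\mathcal S}$ the space of $K$-valued Schwartz functions on $\mathbb R$ that vanish at $0$ faster than any polynomial; $\tilde{\mathcal S}\cap\mathcal H^2_\pm$ consists of the elements of $\tilde{\mathcal S}$ that are boundary values of $\mathcal H^2_\pm$ functions. Let $\psi^-$ have wave function $\langle{}^-s|\psi^-\rangle=\psi(s)\in\tilde{\mathcal S}\cap\mathcal H^2_+$ and $\phi^+$ wave function $\langle{}^+s|\phi^+\rangle=\phi(s)\in\tilde{\mathcal S}\cap\mathcal H^2_-$, continued analytically to the upper, respectively lower, half-plane, and write $$\langle\psi^-|s^-\rangle\langle{}^+s|\phi^+\rangle:=\big(\psi(\bar s),\phi(s)\big)_K,\qquad \operatorname{Im}s\le0,\qquad (\psi^-,\phi^+):=\int_{s_0}^{\infty}ds\,\langle\psi^-|s^-\rangle S(s+i0)\langle{}^+s|\phi^+\rangle .$$ **Statement.** 0. Every element of $\tilde{\mathcal S}\cap\mathcal H^2_\mp$ is determined by its restriction to $[s_0,\infty)$. 1. Let $C_i$ be a circle around $s_{R_i}$, run clockwise, whose closed disc lies in the open lower half-plane and contains no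 other $s_{R_j}$, and let $C_r$ be the lower semicircle of radius $r$ about $0$ from $-r$ to $r$. The integrals of $\langle\psi^-|s^-\rangle S(s)\langle{}^+s|\phi^+\rangle$ over $[s_0,\infty)$ (physical values) and over $(-\infty,s_0]$ (values on the second sheet) converge absolutely, and for all $r>\max(|s_0|,|s_{R_1}|,\dots,|s_{R_N}|)$ the integral over $[s_0,r]$ equals $$\int_{s_0}^{-r}ds\,\langle\psi^-|s^-\rangle S_{II}(s)\langle{}^+s|\phi^+\rangle+\sum_{i=1}^N\int_{C_i}ds\,\langle\psi^-|s^-\rangle S_{II}(s)\langle{}^+s|\phi^+\rangle+\int_{C_r}ds\,\langle\psi^-|s^-\rangle S_{II}(s)\langle{}^+s|\phi^+\rangle .$$ The semicircle does not contribute in the limit: $\int_{C_r}|ds\,\langle\psi^-|s^-\rangle S_{II}(s)\langle{}^+s|\phi^+\rangle|\to0$ as $r\to\infty$. Hence $$(\psi^-,\phi^+)=\int_{s_0}^{-\infty_{II}}ds\,\langle\psi^-|s^-\rangle S_{II}(s)\langle{}^+s|\phi^+\rangle+\sum_{i=1}^N\int_{C_i}ds\,\langle\psi^-|s^-\rangle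 S_{II}(s)\langle{}^+s|\phi^+\rangle .$$ 2. For each $i$, $$\int_{C_i}ds\,\langle\psi^-|s^-\rangle S_{II}(s)\langle{}^+s|\phi^+\rangle=\int_{C_i}ds\,\langle\psi^-|s^-\rangle\frac{R^{(i)}}{s-s_{R_i}}\langle{}^+s|\phi^+\rangle=-2\pi iR^{(i)}\langle\psi^-|s_{R_i}^-\rangle\langle{}^+s_{R_i}|\phi^+\rangle=\int_{-\infty_{II}}^{\infty}ds\,\langle\psi^-|s^-\rangle\frac{R^{(i)}}{s-s_{R_i}}\langle{}^+s|\phi^+\rangle ,$$ the last integral, with the exact Breit–Wigner amplitude $R^{(i)}/(s-s_{R_i})$ on the whole real line, being absolutely convergent. 3. For each $i$ and each $k\in K$ (with $\langle\psi^-|k,s^-\rangle:=(\psi(\bar s),k)_K$; for $K=\mathbb C$, $k=1$ this is $\langle\psi^-|s^-\rangle$) the Gamow ket $$|k,s_{R_i}^-\rangle=\frac{i}{2\pi}\int_{-\infty}^{\infty}ds\,|k,s^-\rangle\frac1{s-s_{R_i}}$$ is a well-defined continuous antilinear functional on $\tilde{\mathcal S}\cap\mathcal H^2_+$ (with the topology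 induced by the Schwartz space), its integral converges absolutely on every $\psi^-$, and its value at $\psi^-$ is the value $\langle\psi^-|k,s_{R_i}^-\rangle$ of the analytic continuation at the pole. If moreover $\phi(s_{R_i})=c\,k$ with $c\in\mathbb C\setminus\{0\}$, then $$\langle\psi^-|k,s_{R_i}^-\rangle=\frac{i}{2\pi}\int_{-\infty}^{\infty}ds\,\frac{1}{s-s_{R_i}}\,\frac{\langle\psi^-|s^-\rangle\langle{}^+s|\phi^+\rangle}{c},$$ which for $K=\mathbb C$, $k=1$ is $|s_{R_i}^-\rangle=\frac i{2\pi}\int ds\,|s^-\rangle\frac1{s-s_{R_i}}\frac{\langle{}^+s|\phi^+\rangle}{\langle{}^+s_{R_i}|\phi^+\rangle}$. -/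

import Mathlib

open Complex Filter Topology MeasureTheory Set Asymptotics
open scoped ComplexConjugate SchwartzMap

noncomputable section

/-- Hardy class of order `2` of a half-plane, with values in `K`. The half-plane is
`{z | z.im ∈ Y}`: `Y = Ioi 0` gives `H²₊` (upper half-plane), `Y = Iio 0` gives `H²₋`
(lower half-plane). Membership only restricts `F` on the open half-plane. -/
structure IsHardyTwo {K : Type*} [NormedAddCommGroup K] [InnerProductSpace ℂ K]
    (Y : Set ℝ) (F : ℂ → K) : Prop where
  analytic : DifferentiableOn ℂ F {z : ℂ | z.im ∈ Y}
  memLp : ∀ y ∈ Y, MemLp (fun x : ℝ => F ((x : ℂ) + (y : ℂ) * I)) 2 volume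
  bounded : ∃ C : NNReal, ∀ y ∈ Y,
    eLpNorm (fun x : ℝ => F ((x : ℂ) + (y : ℂ) * I)) 2 volume ≤ (C : ENNReal)

/-- `F` is the continuation of the Schwartz function `f` to a half-plane as a Hardy function:
`F` is of Hardy class on the open half-plane, has the boundary values `f` almost everywhere,
and on the real axis `F` denotes `f` itself. -/
structure IsHardyExtension {K : Type*} [NormedAddCommGroup K] [InnerProductSpace ℂ K]
    (Y : Set ℝ) (f : 𝓢(ℝ, K)) (F : ℂ → K) : Prop where
  hardy : IsHardyTwo Y F
  boundary : ∀ᵐ x : ℝ, Tendsto (fun y : ℝ => F ((x : ℂ) + (y : ℂ) * I)) (𝓝[Y] 0) (𝓝 (f x))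
  on_real : ∀ x : ℝ, F (x : ℂ) = f x

lemma IsHardyExtension.zero {K : Type*} [NormedAddCommGroup K] [InnerProductSpace ℂ K]
    (Y : Set ℝ) : IsHardyExtension Y (0 : 𝓢(ℝ, K)) (fun _ => 0) where
  hardy := ⟨differentiableOn_const _, fun _ _ => MemLp.zero', ⟨0, fun _ _ => by simp⟩⟩
  boundary := Eventually.of_forall fun x => by
    exact tendsto_const_nhds
  on_real := fun x => by simp

lemma IsHardyExtension.add {K : Type*} [NormedAddCommGroup K] [InnerProductSpace ℂ K]
    {Y : Set ℝ} {f g : 𝓢(ℝ, K)} {F G : ℂ → K} (hF : IsHardyExtension Y f F)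
    (hG : IsHardyExtension Y g G) : IsHardyExtension Y (f + g) (fun z => F z + G z) where
  hardy := by
    refine ⟨hF.hardy.analytic.add hG.hardy.analytic,
      fun y hy => (hF.hardy.memLp y hy).add (hG.hardy.memLp y hy), ?_⟩
    obtain ⟨C, hC⟩ := hF.hardy.bounded
    obtain ⟨D, hD⟩ := hG.hardy.bounded
    refine ⟨C + D, fun y hy => ?_⟩
    push_cast
    exact (eLpNorm_add_le (hF.hardy.memLp y hy).1 (hG.hardy.memLp y hy).1 (by norm_num)).trans
      (add_le_add (hC y hy) (hD y hy))
  boundary := by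
    filter_upwards [hF.boundary, hG.boundary] with x h1 h2
    simpa using h1.add h2
  on_real := fun x => by simp [hF.on_real, hG.on_real]

lemma IsHardyExtension.smul {K : Type*} [NormedAddCommGroup K] [InnerProductSpace ℂ K]
    {Y : Set ℝ} {f : 𝓢(ℝ, K)} {F : ℂ → K} (c : ℂ) (hF : IsHardyExtension Y f F) :
    IsHardyExtension Y (c • f) (fun z => c • F z) where
  hardy := by
    refine ⟨hF.hardy.analytic.const_smul c, fun y hy => (hF.hardy.memLp y hy).const_smul c, ?_⟩
    obtain ⟨C, hC⟩ := hF.hardy.bounded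
    refine ⟨‖c‖₊ * C, fun y hy => ?_⟩
    push_cast
    exact eLpNorm_const_smul_le.trans (mul_le_mul_right (hC y hy) _)
  boundary := by
    filter_upwards [hF.boundary] with x h1
    simpa using h1.const_smul c
  on_real := fun x => by simp [hF.on_real]

/-- The space `S̃ ∩ H²` of the half-plane given by `Y`: Schwartz functions on the line which
vanish at zero faster than any polynomial and are boundary values of a Hardy function. As a
subspace of the Schwartz space it carries the induced topology. -/
def waveSpace (K : Type*) [NormedAddCommGroup K] [InnerProductSpace ℂ K] (Y : Set ℝ) :
    Submodule ℂ 𝓢(ℝ, K) where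
  carrier := {f | (∀ n : ℕ, (fun x : ℝ => f x) =o[𝓝 0] (fun x : ℝ => x ^ n)) ∧
    ∃ F : ℂ → K, IsHardyExtension Y f F}
  zero_mem' := ⟨fun n => isLittleO_zero _ _, _, IsHardyExtension.zero Y⟩
  add_mem' := fun {f g} hf hg => by
    obtain ⟨h1, F, hF⟩ := hf
    obtain ⟨h2, G, hG⟩ := hg
    exact ⟨fun n => (h1 n).add (h2 n), _, hF.add hG⟩
  smul_mem' := fun c f hf => by
    obtain ⟨h1, F, hF⟩ := hf
    exact ⟨fun n => (h1 n).const_smul_left c, _, hF.smul c⟩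

/-- Wave functions `s ↦ ⟨⁻s|ψ⁻⟩` of the out-observables `ψ⁻ ∈ Φ₊`: the space `S̃ ∩ H²₊`.
The values lie in the Hilbert space `K` of the labels other than `s`: `K = ℂ` when these are
suppressed, `K = L²(ℝ³, d³p/2p⁰) ⊗ ℂ^(2j+1)` when velocity and spin component are displayed. -/
abbrev outSpace (K : Type*) [NormedAddCommGroup K] [InnerProductSpace ℂ K] :
    Submodule ℂ 𝓢(ℝ, K) := waveSpace K (Ioi 0)

/-- Wave functions `s ↦ ⟨⁺s|φ⁺⟩` of the in-states `φ⁺ ∈ Φ₋`: the space `S̃ ∩ H²₋`. -/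
abbrev inSpace (K : Type*) [NormedAddCommGroup K] [InnerProductSpace ℂ K] :
    Submodule ℂ 𝓢(ℝ, K) := waveSpace K (Iio 0)

/-- The two-sheeted Riemann surface of `√(s - s₀)` is the plane of the coordinate `w` with
`w² = s - s₀`. The first (physical) sheet is `0 < w.im`, the second sheet is `w.im < 0`, they
meet along the two edges `0 < w` and `w < 0` of the cut `s₀ < s`, and `w = 0` is the branch
point. The lower half of the second sheet is the quadrant `0 < w.re`, `w.im < 0`.
`rootII s₀ s` is the `w` of the point over `s` in the closed lower half of the second sheet,
i.e. the square root of `s - s₀` with `-π ≤ Arg (s - s₀) ≤ 0`. (Complex conjugation moves the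
cut of the principal root to the other side.) -/
def rootII (s₀ : ℝ) (s : ℂ) : ℂ := conj ((conj (s - (s₀ : ℂ))) ^ (1 / 2 : ℂ))

/-- The standing assumptions on the partial S-matrix `S`, a function on the two-sheeted surface
(of the coordinate `w`), with resonance poles at the `s`-values `sR i` in the lower half of the
second sheet, with residues `R i` in the variable `s`. -/
structure IsPartialSMatrix (s₀ : ℝ) {N : ℕ} (sR R : Fin N → ℂ) (S : ℂ → ℂ) : Prop where
  /-- There are no singularities other than poles on the surface. -/
  meromorphic : MeromorphicOn S univ
  /-- No poles on the first sheet, except possibly bound states at real `s < s₀`. -/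
  analytic_first : ∀ w : ℂ, 0 < w.im → w.re ≠ 0 → AnalyticAt ℂ S w
  /-- In the closed lower half of the second sheet (including both its edges and the branch
  point) the only singularities are the resonance poles. -/
  analytic_second : ∀ w : ℂ, 0 ≤ w.re → w.im ≤ 0 → (∀ i, w ≠ rootII s₀ (sR i)) →
    AnalyticAt ℂ S w
  pole_im : ∀ i, (sR i).im < 0
  pole_injective : Function.Injective sR
  /-- First-order pole with residue `R i`. -/
  simple_pole : ∀ i, R i ≠ 0 ∧ ∃ g : ℂ → ℂ, AnalyticAt ℂ g (sR i) ∧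
    ∀ᶠ s in 𝓝[≠] (sR i), S (rootII s₀ s) = R i / (s - sR i) + g s
  /-- Polynomial bound for large `|s|` in the closed lower half of the second sheet. -/
  poly_bound : ∃ (P : Polynomial ℂ) (r : ℝ), ∀ s : ℂ, s.im ≤ 0 → r ≤ ‖s‖ →
    ‖S (rootII s₀ s)‖ ≤ ‖P.eval s‖

/-- `⟨ψ⁻|s⁻⟩⟨⁺s|φ⁺⟩` at a point `s` of the closed lower half-plane, where `Ψ` is the
continuation of the wave function of `ψ⁻` upwards and `Φ` that of `φ⁺` downwards. -/
def braKet {K : Type*} [NormedAddCommGroup K] [InnerProductSpace ℂ K] (Ψ Φ : ℂ → K) (s : ℂ) :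
    ℂ := inner ℂ (Ψ (conj s)) (Φ s)

/-- The continued integrand `⟨ψ⁻|s⁻⟩ S_II(s) ⟨⁺s|φ⁺⟩` on the lower half of the second sheet. -/
def integrandII {K : Type*} [NormedAddCommGroup K] [InnerProductSpace ℂ K] (s₀ : ℝ) (S : ℂ → ℂ)
    (Ψ Φ : ℂ → K) (s : ℂ) : ℂ := S (rootII s₀ s) * braKet Ψ Φ s

/-- The integrand of the matrix element at a physical `s ≥ s₀`; the physical value
`S(s + i0)` is the value of `S` at the point `w = √(s - s₀)` of the edge of the cut. -/
def physicalIntegrand {K : Type*} [NormedAddCommGroup K] [InnerProductSpace ℂ K] (s₀ : ℝ)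
    (S : ℂ → ℂ) (ψ φ : 𝓢(ℝ, K)) (s : ℝ) : ℂ :=
  S ((Real.sqrt (s - s₀) : ℝ) : ℂ) * inner ℂ (ψ s) (φ s)

/-- The partial S-matrix element `(ψ⁻, φ⁺)`, an integral over the physical values. -/
def matrixElement {K : Type*} [NormedAddCommGroup K] [InnerProductSpace ℂ K] (s₀ : ℝ)
    (S : ℂ → ℂ) (ψ φ : 𝓢(ℝ, K)) : ℂ := ∫ s in Ici s₀, physicalIntegrand s₀ S ψ φ s

/-- The background term: the integral from `s₀` to `-∞` along the real axis of the second
sheet. -/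
def backgroundTerm {K : Type*} [NormedAddCommGroup K] [InnerProductSpace ℂ K] (s₀ : ℝ)
    (S : ℂ → ℂ) (Ψ Φ : ℂ → K) : ℂ := -∫ s in Iic s₀, integrandII s₀ S Ψ Φ (s : ℂ)

/-- Integral along the circle of centre `c` and radius `ρ` in the negative direction. -/
def clockwiseIntegral (F : ℂ → ℂ) (c : ℂ) (ρ : ℝ) : ℂ := -∮ z in C(c, ρ), F z

/-- Integral along the semicircle of radius `r` about `0` in the lower half-plane,
from `-r` to `r`. -/
def semicircleIntegral (F : ℂ → ℂ) (r : ℝ) : ℂ :=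
  ∫ θ in (-Real.pi)..0, F (circleMap 0 r θ) * (circleMap 0 r θ * I)

/-- Integral of `|F(z) dz|` along the same semicircle. -/
def semicircleAbsIntegral (F : ℂ → ℂ) (r : ℝ) : ℝ :=
  ∫ θ in (-Real.pi)..0, ‖F (circleMap 0 r θ)‖ * r

/-- Radii of circles around the poles: the closed discs lie in the open lower half-plane and
each contains only the pole at its centre. -/
def IsAdmissibleRadii {N : ℕ} (sR : Fin N → ℂ) (ρ : Fin N → ℝ) : Prop :=
  ∀ i, 0 < ρ i ∧ Metric.closedBall (sR i) (ρ i) ⊆ {z : ℂ | z.im < 0} ∧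
    ∀ j, j ≠ i → sR j ∉ Metric.closedBall (sR i) (ρ i)

/-- The Breit–Wigner amplitude `R / (s - s_R)`; it is exact when `s` runs over the whole line. -/
def breitWigner (R zR s : ℂ) : ℂ := R / (s - zR)

/-- The Gamow ket `(i/2π) ∫ ds |s⁻⟩ / (s - s_R)` over the whole real line, as a functional of the
out-observable `ψ⁻`. The ket `|s⁻⟩` with label vector `k ∈ K` is `ψ ↦ ⟪ψ(s), k⟫`, so that for
`K = ℂ`, `k = 1` it is `ψ ↦ conj ψ(s)`. -/
def gamowKet {K : Type*} [NormedAddCommGroup K] [InnerProductSpace ℂ K] (zR : ℂ) (k : K)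
    (ψ : outSpace K) : ℂ :=
  I / (2 * (Real.pi : ℂ)) * ∫ s : ℝ, inner ℂ ((ψ : 𝓢(ℝ, K)) s) k * (1 / ((s : ℂ) - zR))

end

/-! ### Cauchy's theorem and integral formula for half-discs in the lower half-plane. -/

section HalfDisc

variable {E : Type*} [NormedAddCommGroup E] [NormedSpace ℂ E]

/-! The Hardy hypotheses give only square-integrable slices and almost-everywhere boundary limits.
The analytic core is that, for Schwartz boundary values, they already force continuity up to the
real axis and decay faster than every power in the whole closed half-plane (`IsRapidLower`). Submean
values turn the slice bound into boundedness on each half-plane `im z ≤ -δ`. The Poisson formula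
holds for the translate by `-iδ`, and truncation in `L²` lets `δ → 0`
(`eq_integral_lowerPoisson_boundary`). A rescaled Poisson integral then gives continuity and
boundedness, and Phragmén–Lindelöf carries the decay from the axis into the half-plane
(`isRapidLower_of_hardy`).

The bracket `(ψ(conj s), φ(s))` is holomorphic because its two antiholomorphic dependences cancel,
and it decays rapidly. On the closed lower half of the second sheet, `S` is a continuous function of
polynomial growth, holomorphic inside, plus the kernels `R i / (s - sR i)`
(`IsPartialSMatrix.exists_regular_part`). The integrand is therefore a rapidly decreasing function
plus Cauchy kernels times one (`HasPoleDecomposition`).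

Everything about contours follows from this shape and the half-disc Cauchy formula. The large
semicircle vanishes, the residues at the poles equal the integrals over the small circles, and the
part of the real line below threshold is the background term. Cauchy's formula over the whole line,
for one kernel, gives the Breit–Wigner integrals and the Gamow kets.

Uniqueness from the half-axis above threshold is a two-constants argument: in logarithmic
coordinates the half-plane becomes a strip, and vanishing on one edge forces vanishing inside. -/

lemma circleMap_im_nonpos {r θ : ℝ} (hr : 0 ≤ r) (h1 : -Real.pi ≤ θ) (h2 : θ ≤ 0) :
    (circleMap 0 r θ).im ≤ 0 := by
  have : (circleMap 0 r θ).im = r * Real.sin θ := by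
    simp [circleMap, exp_ofReal_mul_I_im]
  rw [this]
  exact mul_nonpos_of_nonneg_of_nonpos hr (Real.sin_nonpos_of_nonpos_of_neg_pi_le h2 h1)

/-- Polar form of Cauchy's theorem for a half-annulus in the lower half-plane. -/
lemma semicircle_sub_semicircle [CompleteSpace E] (B : ℂ → E) {ε r : ℝ} (hε : 0 < ε) (hεr : ε ≤ r)
    (hc : ContinuousOn B {z | z.im ≤ 0 ∧ ‖z‖ ≤ r})
    (hd : DifferentiableOn ℂ B {z | z.im < 0 ∧ ‖z‖ < r}) :
    ((∫ θ in (-Real.pi)..0, (circleMap 0 r θ * I) • B (circleMap 0 r θ)) -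
      ∫ θ in (-Real.pi)..0, (circleMap 0 ε θ * I) • B (circleMap 0 ε θ)) =
      (∫ x in ε..r, B (x : ℂ)) + ∫ x in (-r)..(-ε), B (x : ℂ) := by
  have hr : 0 < r := hε.trans_le hεr
  have hlog : Real.log ε ≤ Real.log r := Real.log_le_log hε hεr
  have hπ := Real.pi_pos
  -- The substitution `z = exp w` maps the rectangle `[log ε, log r] × [-π, 0]` to the half-annulus
  -- and pulls `B z dz` back to `exp w • B (exp w) dw`. The rectangle theorem asks only for
  -- continuity on the boundary, so holomorphy across the real axis is not needed.
  have key := integral_boundary_rect_eq_zero_of_continuousOn_of_differentiableOn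
    (fun w : ℂ => exp w • B (exp w)) ⟨Real.log ε, -Real.pi⟩ ⟨Real.log r, 0⟩ ?_ ?_
  · have hexp : ∀ x : ℝ, exp ((x : ℂ) + ((-Real.pi : ℝ) : ℂ) * I) = -((Real.exp x : ℝ) : ℂ) := by
      intro x
      rw [exp_add]
      push_cast
      rw [neg_mul, exp_neg, exp_pi_mul_I]
      norm_num
    have hexp2 : ∀ ρ : ℝ, 0 < ρ → ∀ y : ℝ,
        exp (((Real.log ρ : ℝ) : ℂ) + (y : ℂ) * I) = circleMap 0 ρ y := by
      intro ρ hρ y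
      rw [exp_add, ← ofReal_exp, Real.exp_log hρ]
      simp [circleMap]
    simp only at key
    simp_rw [hexp, hexp2 r hr, hexp2 ε hε] at key
    have e1 : (∫ x in Real.log ε..Real.log r, exp ((x : ℂ) + ((0 : ℝ) : ℂ) * I) •
        B (exp ((x : ℂ) + ((0 : ℝ) : ℂ) * I))) = ∫ x in ε..r, B (x : ℂ) := by
      have := intervalIntegral.integral_deriv_smul_comp'' (a := Real.log ε) (b := Real.log r)
        (f := Real.exp) (f' := Real.exp) (g := fun x : ℝ => B (x : ℂ))
        Real.continuous_exp.continuousOn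
        (fun x _ => (Real.hasDerivAt_exp x).hasDerivWithinAt) Real.continuous_exp.continuousOn ?_
      · rw [Real.exp_log hε, Real.exp_log hr] at this
        rw [← this]
        refine intervalIntegral.integral_congr fun x _ => ?_
        simp [← ofReal_exp]
      · refine hc.comp continuous_ofReal.continuousOn ?_
        rintro _ ⟨x, hx, rfl⟩
        rw [uIcc_of_le hlog] at hx
        simp only [mem_ofPred_eq, ofReal_im, le_refl, norm_real, Real.norm_eq_abs, Real.abs_exp,
          true_and]
        rw [← Real.exp_log hr]
        exact Real.exp_le_exp.2 hx.2
    have e2 : (∫ x in Real.log ε..Real.log r, (-((Real.exp x : ℝ) : ℂ)) •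
        B (-((Real.exp x : ℝ) : ℂ))) = - ∫ x in (-r)..(-ε), B (x : ℂ) := by
      have := intervalIntegral.integral_deriv_smul_comp'' (a := Real.log ε) (b := Real.log r)
        (f := Real.exp) (f' := Real.exp) (g := fun x : ℝ => B (-(x : ℂ)))
        Real.continuous_exp.continuousOn
        (fun x _ => (Real.hasDerivAt_exp x).hasDerivWithinAt) Real.continuous_exp.continuousOn ?_
      · rw [Real.exp_log hε, Real.exp_log hr] at this
        have h2 := intervalIntegral.integral_comp_neg (a := ε) (b := r) (fun x : ℝ => B (x : ℂ))
        simp only [ofReal_neg] at h2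
        rw [← h2, ← this, ← intervalIntegral.integral_neg]
        refine intervalIntegral.integral_congr fun x _ => ?_
        simp [-ofReal_exp]
      · refine hc.comp continuous_ofReal.neg.continuousOn ?_
        rintro _ ⟨x, hx, rfl⟩
        rw [uIcc_of_le hlog] at hx
        simp only [mem_ofPred_eq, ofReal_im, norm_real, Real.norm_eq_abs, Real.abs_exp,
          neg_im, neg_zero, le_refl, norm_neg, true_and]
        rw [← Real.exp_log hr]
        exact Real.exp_le_exp.2 hx.2
    rw [e1, e2, ← intervalIntegral.integral_smul, ← intervalIntegral.integral_smul] at key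
    simp_rw [smul_smul, mul_comm I] at key
    rw [← sub_eq_zero]
    rw [← key]
    abel
  · refine ContinuousOn.smul continuous_exp.continuousOn (hc.comp continuous_exp.continuousOn ?_)
    intro w hw
    rw [mem_reProdIm, uIcc_of_le hlog, uIcc_of_le (by simpa using hπ.le)] at hw
    obtain ⟨⟨_, h2⟩, h3, h4⟩ := hw
    simp only at h2 h3 h4
    refine ⟨?_, ?_⟩
    · rw [exp_im]
      exact mul_nonpos_of_nonneg_of_nonpos (Real.exp_pos _).le
        (Real.sin_nonpos_of_nonpos_of_neg_pi_le h4 h3)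
    · rw [norm_exp, ← Real.exp_log hr]
      exact Real.exp_le_exp.2 h2
  · refine DifferentiableOn.smul differentiable_exp.differentiableOn
      (hd.comp differentiable_exp.differentiableOn ?_)
    intro w hw
    rw [mem_reProdIm] at hw
    simp only [min_eq_left hlog, max_eq_right hlog, min_eq_left (neg_nonpos.2 hπ.le),
      max_eq_right (neg_nonpos.2 hπ.le)] at hw
    obtain ⟨⟨_, h2⟩, h3, h4⟩ := hw
    refine ⟨?_, ?_⟩
    · rw [exp_im]
      exact mul_neg_of_pos_of_neg (Real.exp_pos _)
        (Real.sin_neg_of_neg_of_neg_pi_lt h4 h3)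
    · rw [norm_exp, ← Real.exp_log hr]
      exact Real.exp_lt_exp.2 h2

/-- Cauchy's theorem for a half-disc in the lower half-plane. -/
lemma semicircle_eq_integral [CompleteSpace E] (B : ℂ → E) {r : ℝ} (hr : 0 < r)
    (hc : ContinuousOn B {z | z.im ≤ 0 ∧ ‖z‖ ≤ r})
    (hd : DifferentiableOn ℂ B {z | z.im < 0 ∧ ‖z‖ < r}) :
    (∫ θ in (-Real.pi)..0, (circleMap 0 r θ * I) • B (circleMap 0 r θ)) =
      ∫ x in (-r)..r, B (x : ℂ) := by
  have hπ := Real.pi_pos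
  have hcpt : IsCompact {z : ℂ | z.im ≤ 0 ∧ ‖z‖ ≤ r} := by
    have : {z : ℂ | z.im ≤ 0 ∧ ‖z‖ ≤ r} = Metric.closedBall 0 r ∩ {z | z.im ≤ 0} := by
      ext z; simp [and_comm]
    rw [this]
    exact (isCompact_closedBall _ _).inter_right (isClosed_le continuous_im continuous_const)
  obtain ⟨M, hM⟩ := hcpt.exists_bound_of_continuousOn hc
  have hreal : ContinuousOn (fun x : ℝ => B (x : ℂ)) (Icc (-r) r) := by
    refine hc.comp continuous_ofReal.continuousOn fun x hx => ?_
    simpa using abs_le.2 hx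
  have hint : ∀ a ∈ Icc (-r) r, ∀ b ∈ Icc (-r) r,
      IntervalIntegrable (fun x : ℝ => B (x : ℂ)) volume a b := fun a ha b hb =>
    (hreal.mono (uIcc_subset_Icc ha hb)).intervalIntegrable
  -- The error is the small semicircle (length `π ε`) minus the excised segment (length `2 ε`), each
  -- bounded by `M` times its length. It does not depend on `ε`, so it is zero.
  have bound : ∀ ε ∈ Ioc 0 r,
      ‖(∫ θ in (-Real.pi)..0, (circleMap 0 r θ * I) • B (circleMap 0 r θ)) -
      ∫ x in (-r)..r, B (x : ℂ)‖ ≤ ε * (M * Real.pi + 2 * M) := by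
    rintro ε ⟨h0, h1⟩
    have h := semicircle_sub_semicircle B h0 h1 hc hd
    have hsplit : (∫ x in (-r)..r, B (x : ℂ)) = (∫ x in (-r)..(-ε), B (x : ℂ)) +
        (∫ x in (-ε)..ε, B (x : ℂ)) + ∫ x in ε..r, B (x : ℂ) := by
      rw [intervalIntegral.integral_add_adjacent_intervals,
        intervalIntegral.integral_add_adjacent_intervals] <;> apply hint <;>
        constructor <;> linarith
    have hA : ‖∫ θ in (-Real.pi)..0, (circleMap 0 ε θ * I) • B (circleMap 0 ε θ)‖ ≤
        (ε * M) * |0 - -Real.pi| := by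
      refine intervalIntegral.norm_integral_le_of_norm_le_const fun θ hθ => ?_
      rw [uIoc_of_le (by linarith)] at hθ
      rw [norm_smul]
      simp only [norm_mul, norm_circleMap_zero, abs_of_pos h0, norm_I, mul_one]
      refine mul_le_mul_of_nonneg_left (hM _ ⟨?_, ?_⟩) h0.le
      · exact circleMap_im_nonpos h0.le hθ.1.le hθ.2
      · simpa [abs_of_pos h0] using h1
    have hB : ‖∫ x in (-ε)..ε, B (x : ℂ)‖ ≤ M * |ε - -ε| := by
      refine intervalIntegral.norm_integral_le_of_norm_le_const fun x hx => ?_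
      rw [uIoc_of_le (by linarith)] at hx
      refine hM _ ⟨by simp, ?_⟩
      rw [norm_real, Real.norm_eq_abs, abs_le]
      constructor <;> linarith [hx.1, hx.2]
    rw [sub_neg_eq_add, zero_add, abs_of_pos hπ] at hA
    rw [sub_neg_eq_add, abs_of_pos (by linarith)] at hB
    have : (∫ θ in (-Real.pi)..0, (circleMap 0 r θ * I) • B (circleMap 0 r θ)) -
        (∫ x in (-r)..r, B (x : ℂ)) =
        (∫ θ in (-Real.pi)..0, (circleMap 0 ε θ * I) • B (circleMap 0 ε θ)) -
        ∫ x in (-ε)..ε, B (x : ℂ) := by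
      rw [hsplit, sub_eq_iff_eq_add.1 h]; abel
    rw [this]
    refine (norm_sub_le _ _).trans ?_
    linarith
  rw [← sub_eq_zero, ← norm_le_zero_iff]
  have hlim : Tendsto (fun ε : ℝ => ε * (M * Real.pi + 2 * M)) (𝓝[>] 0) (𝓝 0) := by
    have : Tendsto (fun ε : ℝ => ε * (M * Real.pi + 2 * M)) (𝓝 0)
        (𝓝 (0 * (M * Real.pi + 2 * M))) := tendsto_id.mul_const _
    rw [zero_mul] at this
    exact this.mono_left nhdsWithin_le_nhds
  refine ge_of_tendsto hlim ?_
  filter_upwards [Ioc_mem_nhdsGT hr] with ε hε using bound ε hε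

/-- The half-disc contour integral of the Cauchy kernel. -/
lemma semicircle_sub_integral_inv {r : ℝ} {a : ℂ} (ha : a.im < 0) (har : ‖a‖ < r) :
    (∫ θ in (-Real.pi)..0, (circleMap 0 r θ * I) • (circleMap 0 r θ - a)⁻¹) -
      (∫ x in (-r)..r, ((x : ℂ) - a)⁻¹) = 2 * Real.pi * I := by
  have hr : 0 < r := (norm_nonneg a).trans_lt har
  have hne : ∀ θ : ℝ, circleMap 0 r θ - a ≠ 0 := fun θ h => by
    have : ‖circleMap 0 r θ‖ = ‖a‖ := by rw [sub_eq_zero.1 h]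
    rw [norm_circleMap_zero, abs_of_pos hr] at this
    linarith
  have hcont : Continuous fun θ : ℝ => (circleMap 0 r θ * I) • (circleMap 0 r θ - a)⁻¹ :=
    ((continuous_circleMap 0 r).mul continuous_const).smul
      (((continuous_circleMap 0 r).sub continuous_const).inv₀ hne)
  have hfull : (∫ θ in (-Real.pi)..Real.pi,
      (circleMap 0 r θ * I) • (circleMap 0 r θ - a)⁻¹) = 2 * Real.pi * I := by
    have h := circleIntegral.integral_sub_inv_of_mem_ball (c := 0) (w := a) (R := r)
      (by simpa using har)
    rw [circleIntegral] at h
    simp only [deriv_circleMap] at h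
    rw [← h]
    have hper : Function.Periodic
        (fun θ : ℝ => (circleMap 0 r θ * I) • (circleMap 0 r θ - a)⁻¹) (2 * Real.pi) := by
      intro θ
      simp only [periodic_circleMap 0 r θ]
    have := hper.intervalIntegral_add_eq (-Real.pi) 0
    rw [zero_add] at this
    rw [← this]
    congr 1
    ring
  have hsub : (∫ θ in (-Real.pi)..0, (circleMap 0 r θ * I) • (circleMap 0 r θ - a)⁻¹) +
      (∫ θ in (0 : ℝ)..Real.pi, (circleMap 0 r θ * I) • (circleMap 0 r θ - a)⁻¹) =
      2 * Real.pi * I := by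
    rw [← hfull]
    exact intervalIntegral.integral_add_adjacent_intervals (hcont.intervalIntegrable _ _)
      (hcont.intervalIntegrable _ _)
  have hne2 : ∀ z : ℂ, z.im ≤ 0 → -z - a ≠ 0 := fun z hz h => by
    have := congrArg im h
    simp only [sub_im, neg_im, zero_im] at this
    linarith
  -- The full circle gives `2πi`. Its upper half is handled by `z ↦ -z`, which turns the kernel into
  -- one whose pole `-a` lies in the upper half-plane, so the half-disc theorem applies.
  have hup := semicircle_eq_integral (fun z => (-z - a)⁻¹) hr
    (ContinuousOn.inv₀ (by fun_prop) fun z hz => hne2 z hz.1)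
    (DifferentiableOn.inv (by fun_prop) fun z hz => hne2 z hz.1.le)
  have h1 : (∫ θ in (-Real.pi)..0, (circleMap 0 r θ * I) • (-circleMap 0 r θ - a)⁻¹) =
      -∫ θ in (0 : ℝ)..Real.pi, (circleMap 0 r θ * I) • (circleMap 0 r θ - a)⁻¹ := by
    have hs := intervalIntegral.integral_comp_add_right (a := -Real.pi) (b := 0)
      (fun θ : ℝ => (circleMap 0 r θ * I) • (circleMap 0 r θ - a)⁻¹) Real.pi
    rw [neg_add_cancel, zero_add] at hs
    rw [← hs, ← intervalIntegral.integral_neg]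
    refine intervalIntegral.integral_congr fun θ _ => ?_
    have : circleMap 0 r (θ + Real.pi) = -circleMap 0 r θ := by
      simp [circleMap, add_mul, exp_add]
    simp [this]
  have h2 : (∫ x in (-r)..r, (-(x : ℂ) - a)⁻¹) = ∫ x in (-r)..r, ((x : ℂ) - a)⁻¹ := by
    have := intervalIntegral.integral_comp_neg (a := -r) (b := r) (fun x : ℝ => ((x : ℂ) - a)⁻¹)
    simpa using this
  rw [h1, h2] at hup
  rw [← hup, sub_neg_eq_add, hsub]

/-- Cauchy's integral formula for a half-disc in the lower half-plane. -/
lemma semicircle_sub_integral_cauchy [CompleteSpace E] (B : ℂ → E) {r : ℝ} {a : ℂ} (ha : a.im < 0)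
    (har : ‖a‖ < r) (hc : ContinuousOn B {z | z.im ≤ 0})
    (hd : DifferentiableOn ℂ B {z | z.im < 0}) :
    (∫ θ in (-Real.pi)..0,
      (circleMap 0 r θ * I) • (circleMap 0 r θ - a)⁻¹ • B (circleMap 0 r θ)) -
      (∫ x in (-r)..r, ((x : ℂ) - a)⁻¹ • B (x : ℂ)) = (2 * Real.pi * I : ℂ) • B a := by
  have hr : 0 < r := (norm_nonneg a).trans_lt har
  have hπ := Real.pi_pos
  have hopen : {z : ℂ | z.im < 0} ∈ 𝓝 a :=
    (isOpen_lt continuous_im continuous_const).mem_nhds ha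
  -- The difference quotient removes the singularity at `a`. The half-disc theorem applies to it,
  -- and what remains is the pure kernel times the constant `B a`.
  have hdd : DifferentiableOn ℂ (dslope B a) {z | z.im < 0} := (differentiableOn_dslope hopen).2 hd
  have hopen' : {z : ℂ | z.im ≤ 0} ∈ 𝓝 a :=
    mem_of_superset hopen fun z (hz : z.im < 0) => hz.le
  have hcc : ContinuousOn (dslope B a) {z | z.im ≤ 0} :=
    (continuousOn_dslope hopen').2
      ⟨hc, hd.differentiableAt hopen⟩
  have h0 := semicircle_eq_integral (dslope B a) hr (hcc.mono fun z hz => hz.1)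
    (hdd.mono fun z hz => hz.1)
  have hne : ∀ θ : ℝ, circleMap 0 r θ - a ≠ 0 := fun θ h => by
    have : ‖circleMap 0 r θ‖ = ‖a‖ := by rw [sub_eq_zero.1 h]
    rw [norm_circleMap_zero, abs_of_pos hr] at this
    linarith
  have hne2 : ∀ x : ℝ, (x : ℂ) - a ≠ 0 := fun x h => by
    have := congrArg im h
    simp only [sub_im, ofReal_im, zero_im] at this
    linarith
  have e : ∀ z : ℂ, z - a ≠ 0 → dslope B a z = (z - a)⁻¹ • B z - (z - a)⁻¹ • B a := fun z hz => by
    rw [dslope_of_ne _ (sub_ne_zero.1 hz), slope_def_module, smul_sub]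
  have hcB : ContinuousOn (fun θ : ℝ => B (circleMap 0 r θ)) (Icc (-Real.pi) 0) :=
    hc.comp (continuous_circleMap 0 r).continuousOn
      fun θ hθ => circleMap_im_nonpos hr.le hθ.1 hθ.2
  have hcont1 : Continuous fun θ : ℝ => (circleMap 0 r θ - a)⁻¹ :=
    ((continuous_circleMap 0 r).sub continuous_const).inv₀ hne
  have hcont2 : Continuous fun x : ℝ => ((x : ℂ) - a)⁻¹ :=
    (continuous_ofReal.sub continuous_const).inv₀ hne2
  have hRB : ContinuousOn (fun x : ℝ => B (x : ℂ)) (uIcc (-r) r) :=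
    hc.comp continuous_ofReal.continuousOn fun x _ => by simp
  have huI : uIcc (-Real.pi) 0 = Icc (-Real.pi) 0 := uIcc_of_le (by linarith)
  rw [← huI] at hcB
  have hmI : Continuous fun θ : ℝ => circleMap 0 r θ * I :=
    (continuous_circleMap 0 r).mul continuous_const
  simp_rw [e _ (hne _), e _ (hne2 _), smul_sub] at h0
  rw [intervalIntegral.integral_sub, intervalIntegral.integral_sub] at h0
  · have hk := semicircle_sub_integral_inv ha har
    have e1 : (∫ θ in (-Real.pi)..0, (circleMap 0 r θ * I) • (circleMap 0 r θ - a)⁻¹ • B a) =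
        (∫ θ in (-Real.pi)..0, (circleMap 0 r θ * I) • (circleMap 0 r θ - a)⁻¹) • B a := by
      rw [← intervalIntegral.integral_smul_const]
      simp [smul_smul]
    have e2 : (∫ x in (-r)..r, ((x : ℂ) - a)⁻¹ • B a) =
        (∫ x in (-r)..r, ((x : ℂ) - a)⁻¹) • B a := by
      rw [← intervalIntegral.integral_smul_const]
    rw [e1, e2] at h0
    rw [← hk, sub_smul]
    rw [sub_eq_sub_iff_add_eq_add] at h0 ⊢
    rw [h0]; abel
  · exact (hcont2.continuousOn.smul hRB).intervalIntegrable
  · exact (hcont2.smul continuous_const).intervalIntegrable _ _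
  · exact (hmI.continuousOn.smul (hcont1.continuousOn.smul hcB)).intervalIntegrable
  · exact (hmI.smul (hcont1.smul continuous_const)).intervalIntegrable _ _

end HalfDisc

/-! ### Poisson integral of bounded holomorphic functions. -/

section Poisson

variable {E : Type*} [NormedAddCommGroup E] [NormedSpace ℂ E]

/-- The Poisson kernel of the lower half-plane at the point `x + y * I`, `y < 0`. -/
noncomputable def lowerPoisson (x y t : ℝ) : ℝ := -y / Real.pi / ((t - x) ^ 2 + y ^ 2)

lemma lowerPoisson_nonneg {x y : ℝ} (hy : y < 0) (t : ℝ) : 0 ≤ lowerPoisson x y t := by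
  have : 0 < -y := by linarith
  unfold lowerPoisson
  positivity

lemma continuous_lowerPoisson {x y : ℝ} (hy : y < 0) : Continuous (lowerPoisson x y) := by
  unfold lowerPoisson
  refine Continuous.div (by fun_prop) (by fun_prop) fun t => ?_
  have := hy.ne
  positivity

lemma lowerPoisson_comp {x y : ℝ} (hy : y < 0) (u : ℝ) :
    lowerPoisson x y (x + y * u) = |y⁻¹| * (Real.pi⁻¹ * (1 + u ^ 2)⁻¹) := by
  have h1 : (x + y * u - x) ^ 2 + y ^ 2 = y ^ 2 * (1 + u ^ 2) := by ring
  have h2 : 1 + u ^ 2 ≠ 0 := by positivity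
  have h3 := Real.pi_ne_zero
  rw [lowerPoisson, h1, abs_of_neg (inv_lt_zero.2 hy)]
  have := hy.ne
  field_simp

/-- Substituting `t = x + y u` makes the density independent of the point and moves the whole
dependence on `(x, y)` into the argument of `g`. The right-hand side still makes sense at `y = 0`,
which is what yields continuity up to the boundary. -/
lemma integral_lowerPoisson_smul {x y : ℝ} (hy : y < 0) (g : ℝ → E) :
    ∫ t, ((lowerPoisson x y t : ℝ) : ℂ) • g t =
      ∫ u, ((Real.pi⁻¹ * (1 + u ^ 2)⁻¹ : ℝ) : ℂ) • g (x + y * u) := by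
  have h1 := Measure.integral_comp_mul_left
    (fun v => ((lowerPoisson x y (x + v) : ℝ) : ℂ) • g (x + v)) y
  rw [integral_add_left_eq_self (fun t => ((lowerPoisson x y t : ℝ) : ℂ) • g t) x] at h1
  have h2 : ∀ u : ℝ, ((lowerPoisson x y (x + y * u) : ℝ) : ℂ) • g (x + y * u) =
      |y⁻¹| • ((Real.pi⁻¹ * (1 + u ^ 2)⁻¹ : ℝ) : ℂ) • g (x + y * u) := fun u => by
    rw [lowerPoisson_comp hy, ofReal_mul, mul_smul, Complex.coe_smul]
  simp_rw [h2] at h1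
  rw [integral_smul] at h1
  exact (smul_right_injective E (abs_pos.2 (inv_ne_zero hy.ne)).ne' h1).symm

lemma integrable_lowerPoisson {x y : ℝ} (hy : y < 0) : Integrable (lowerPoisson x y) := by
  have h : Integrable fun u : ℝ => lowerPoisson x y (x + y * u) := by
    simp_rw [lowerPoisson_comp hy]
    exact (integrable_inv_one_add_sq.const_mul _).const_mul _
  have h2 : Integrable fun v : ℝ => lowerPoisson x y (x + v) :=
    (integrable_comp_mul_left_iff (fun v => lowerPoisson x y (x + v)) hy.ne).1 h
  simpa using h2.comp_add_left (-x)

/-- The kernel at the conjugate point has no pole in the lower half-plane, so subtracting it leaves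
the residue unchanged. It also improves the decay from first to second order, enough for functions
that are merely bounded. -/
lemma lowerPoisson_eq_inv_sub_inv {x y : ℝ} (hy : y < 0) (t : ℝ) :
    ((t : ℂ) - (x + y * I))⁻¹ - ((t : ℂ) - (x - y * I))⁻¹ =
      -(2 * Real.pi * I) * ((lowerPoisson x y t : ℝ) : ℂ) := by
  have hne : ∀ s : ℝ, s ≠ 0 → (t : ℂ) - (x + s * I) ≠ 0 := fun s hs h => by
    have := congrArg im h
    simp at this
    exact hs this
  have h1 := hne y hy.ne
  have h2 := hne (-y) (neg_ne_zero.2 hy.ne)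
  push_cast at h2
  rw [neg_mul, ← sub_eq_add_neg] at h2
  rw [inv_sub_inv h1 h2, lowerPoisson]
  have h3 : ((t : ℂ) - (x + y * I)) * ((t : ℂ) - (x - y * I)) =
      (((t - x) ^ 2 + y ^ 2 : ℝ) : ℂ) := by
    push_cast
    linear_combination (-(y : ℂ) ^ 2) * I_sq
  have h4 : (Real.pi : ℂ) ≠ 0 := ofReal_ne_zero.2 Real.pi_ne_zero
  rw [h3]
  push_cast
  field_simp
  ring

/-- The Poisson integral of a bounded holomorphic function on the lower half-plane. -/
lemma eq_integral_lowerPoisson [CompleteSpace E] {G : ℂ → E} {M : ℝ}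
    (hc : ContinuousOn G {z | z.im ≤ 0}) (hd : DifferentiableOn ℂ G {z | z.im < 0})
    (hM : ∀ z : ℂ, z.im ≤ 0 → ‖G z‖ ≤ M) (x : ℝ) {y : ℝ} (hy : y < 0) :
    G (x + y * I) = ∫ t, ((lowerPoisson x y t : ℝ) : ℂ) • G t := by
  have hπ := Real.pi_pos
  set a : ℂ := x + y * I with ha
  set b : ℂ := x - y * I with hb
  have haim : a.im = y := by simp [ha]
  have hbim : b.im = -y := by simp [hb]
  have hnab : ‖b‖ = ‖a‖ := by
    have : b = conj a := by simp [ha, hb, sub_eq_add_neg]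
    rw [this, norm_conj]
  have hcR : Continuous fun t : ℝ => G t :=
    continuousOn_univ.1 (hc.comp continuous_ofReal.continuousOn fun t _ => by simp)
  have hM0 : 0 ≤ M := (norm_nonneg _).trans (hM 0 (by simp))
  have hint : Integrable fun t : ℝ => ((lowerPoisson x y t : ℝ) : ℂ) • G t := by
    refine ((integrable_lowerPoisson (x := x) hy).norm.mul_const M).mono'
      ((continuous_ofReal.comp (continuous_lowerPoisson hy)).smul hcR).aestronglyMeasurable
      (Eventually.of_forall fun t => ?_)
    rw [norm_smul, norm_real]
    exact mul_le_mul_of_nonneg_left (hM _ (by simp)) (norm_nonneg _)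
  have hnea : ∀ z : ℂ, ‖a‖ < ‖z‖ → z - a ≠ 0 := fun z hz h => by
    rw [sub_eq_zero.1 h] at hz; exact lt_irrefl _ hz
  have hneb : ∀ z : ℂ, z.im ≤ 0 → z - b ≠ 0 := fun z hz h => by
    rw [sub_eq_zero.1 h, hbim] at hz; linarith
  have hneaR : ∀ t : ℝ, (t : ℂ) - a ≠ 0 := fun t h => by
    have := congrArg im h
    simp only [sub_im, ofReal_im, haim, zero_im] at this
    linarith
  have hcauchy : ∀ r : ℝ, ‖a‖ < r →
      (∫ θ in (-Real.pi)..0, (circleMap 0 r θ * I) •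
        ((circleMap 0 r θ - a)⁻¹ - (circleMap 0 r θ - b)⁻¹) • G (circleMap 0 r θ)) +
      (2 * Real.pi * I : ℂ) • (∫ t in (-r)..r, ((lowerPoisson x y t : ℝ) : ℂ) • G t) =
      (2 * Real.pi * I : ℂ) • G a := by
    intro r hr
    have hr0 : 0 < r := (norm_nonneg a).trans_lt hr
    have h1 := semicircle_sub_integral_cauchy G (haim ▸ hy) hr hc hd
    have hbc : ContinuousOn (fun z => (z - b)⁻¹ • G z) {z | z.im ≤ 0} :=
      (ContinuousOn.inv₀ (by fun_prop) hneb).smul hc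
    have hbd : DifferentiableOn ℂ (fun z => (z - b)⁻¹ • G z) {z | z.im < 0} :=
      (DifferentiableOn.inv (by fun_prop) fun z hz => hneb z (le_of_lt hz)).smul hd
    have h2 := semicircle_eq_integral (fun z => (z - b)⁻¹ • G z) hr0
      (hbc.mono fun z hz => hz.1) (hbd.mono fun z hz => hz.1)
    have hmaps : MapsTo (circleMap 0 r) (uIcc (-Real.pi) 0) {z | z.im ≤ 0} := by
      rw [uIcc_of_le (by linarith)]
      exact fun θ hθ => circleMap_im_nonpos hr0.le hθ.1 hθ.2
    have hcm := (continuous_circleMap 0 r).continuousOn (s := uIcc (-Real.pi) 0)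
    have i1 : IntervalIntegrable (fun θ => (circleMap 0 r θ * I) •
        (circleMap 0 r θ - a)⁻¹ • G (circleMap 0 r θ)) volume (-Real.pi) 0 := by
      refine ContinuousOn.intervalIntegrable ?_
      refine (hcm.mul continuousOn_const).smul ((ContinuousOn.inv₀ (hcm.sub continuousOn_const)
        fun θ _ => hnea _ ?_).smul (hc.comp hcm hmaps))
      rwa [norm_circleMap_zero, abs_of_pos hr0]
    have i2 : IntervalIntegrable (fun θ => (circleMap 0 r θ * I) •
        (circleMap 0 r θ - b)⁻¹ • G (circleMap 0 r θ)) volume (-Real.pi) 0 :=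
      ContinuousOn.intervalIntegrable
        ((hcm.mul continuousOn_const).smul (hbc.comp hcm hmaps))
    have i3 : IntervalIntegrable (fun t : ℝ => ((t : ℂ) - a)⁻¹ • G t) volume (-r) r :=
      (((continuous_ofReal.sub continuous_const).inv₀ hneaR).smul hcR).intervalIntegrable _ _
    have i4 : IntervalIntegrable (fun t : ℝ => ((t : ℂ) - b)⁻¹ • G t) volume (-r) r :=
      (((continuous_ofReal.sub continuous_const).inv₀ fun t => hneb _ (by simp)).smul
        hcR).intervalIntegrable _ _
    have e3 : ∀ t : ℝ, ((t : ℂ) - a)⁻¹ • G t - ((t : ℂ) - b)⁻¹ • G t =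
        (-(2 * Real.pi * I : ℂ)) • ((lowerPoisson x y t : ℝ) : ℂ) • G t := fun t => by
      rw [← sub_smul, lowerPoisson_eq_inv_sub_inv hy, smul_smul]
    simp_rw [sub_smul, smul_sub]
    rw [intervalIntegral.integral_sub i1 i2, h2, ← h1]
    have h5 := intervalIntegral.integral_sub i3 i4
    simp_rw [e3] at h5
    rw [intervalIntegral.integral_smul, neg_smul] at h5
    rw [← sub_eq_zero] at h5 ⊢
    rw [← neg_eq_zero, ← h5]
    abel
  have hlim1 : Tendsto (fun r : ℝ => ∫ θ in (-Real.pi)..0, (circleMap 0 r θ * I) •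
        ((circleMap 0 r θ - a)⁻¹ - (circleMap 0 r θ - b)⁻¹) • G (circleMap 0 r θ))
      atTop (𝓝 0) := by
    -- For `r > 2‖a‖` both denominators are at least `r / 2`, so the kernel difference is at most
    -- `8‖a‖ / r²`. The arc has length `π r` and `G` is at most `M`.
    have hz : Tendsto (fun r : ℝ => 8 * ‖a‖ * M * Real.pi * r⁻¹) atTop (𝓝 0) := by
      simpa using tendsto_inv_atTop_zero.const_mul (8 * ‖a‖ * M * Real.pi)
    refine squeeze_zero_norm' ?_ hz
    filter_upwards [eventually_gt_atTop (2 * ‖a‖), eventually_gt_atTop 0] with r hr hr0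
    have : ‖∫ θ in (-Real.pi)..0, (circleMap 0 r θ * I) •
        ((circleMap 0 r θ - a)⁻¹ - (circleMap 0 r θ - b)⁻¹) • G (circleMap 0 r θ)‖ ≤
        (8 * ‖a‖ * M * r⁻¹) * |0 - -Real.pi| := by
      refine intervalIntegral.norm_integral_le_of_norm_le_const fun θ hθ => ?_
      rw [uIoc_of_le (by linarith)] at hθ
      have hn : ‖circleMap 0 r θ‖ = r := by rw [norm_circleMap_zero, abs_of_pos hr0]
      have him := circleMap_im_nonpos hr0.le hθ.1.le hθ.2
      set z := circleMap 0 r θ with hz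
      rw [norm_smul, norm_smul, norm_mul, norm_I, mul_one, hn,
        inv_sub_inv (hnea z (by rw [hn]; linarith [norm_nonneg a])) (hneb z him), norm_div,
        norm_mul]
      have k1 : r / 2 ≤ ‖z - a‖ := by
        have := norm_sub_norm_le z a; rw [hn] at this; linarith
      have k2 : r / 2 ≤ ‖z - b‖ := by
        have := norm_sub_norm_le z b; rw [hn, hnab] at this; linarith
      have k3 : ‖z - b - (z - a)‖ ≤ 2 * ‖a‖ := by
        rw [sub_sub_sub_cancel_left]
        refine (norm_sub_le _ _).trans ?_
        rw [hnab]; linarith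
      have k4 : ‖z - b - (z - a)‖ / (‖z - a‖ * ‖z - b‖) ≤ (2 * ‖a‖) / (r / 2 * (r / 2)) := by
        gcongr
      calc r * (‖z - b - (z - a)‖ / (‖z - a‖ * ‖z - b‖) * ‖G z‖)
          ≤ r * ((2 * ‖a‖) / (r / 2 * (r / 2)) * M) := by
            gcongr
            exact hM z him
        _ = 8 * ‖a‖ * M * r⁻¹ := by field_simp; ring
    refine this.trans_eq ?_
    rw [sub_neg_eq_add, zero_add, abs_of_pos hπ]
    ring
  have hlim2 : Tendsto (fun r : ℝ => ∫ t in (-r)..r, ((lowerPoisson x y t : ℝ) : ℂ) • G t) atTop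
      (𝓝 (∫ t, ((lowerPoisson x y t : ℝ) : ℂ) • G t)) :=
    intervalIntegral_tendsto_integral hint tendsto_neg_atTop_atBot tendsto_id
  have hlim := hlim1.add (hlim2.const_smul (2 * Real.pi * I : ℂ))
  rw [zero_add] at hlim
  have hlim' : Tendsto (fun _ : ℝ => (2 * Real.pi * I : ℂ) • G a) atTop
      (𝓝 ((2 * Real.pi * I : ℂ) • ∫ t, ((lowerPoisson x y t : ℝ) : ℂ) • G t)) := by
    refine hlim.congr' ?_
    filter_upwards [eventually_gt_atTop ‖a‖] with r hr using hcauchy r hr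
  have h0 : (2 * Real.pi * I : ℂ) ≠ 0 := two_pi_I_ne_zero
  exact smul_right_injective E h0 (tendsto_nhds_unique tendsto_const_nhds hlim')

end Poisson

/-! ### Interior bounds for Hardy functions. -/

section HardyBound

variable {E : Type*} [NormedAddCommGroup E] [NormedSpace ℂ E]

lemma measurable_indicator_enorm {E : Type*} [NormedAddCommGroup E] {F : ℂ → E} {U : Set ℂ} (hU : IsOpen U) (hF : ContinuousOn F U) :
    Measurable (U.indicator fun w => ‖F w‖ₑ) := by
  classical
  have h := ContinuousOn.measurable_piecewise (s := U) (f := fun w => ‖F w‖ₑ)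
    (g := fun _ => (0 : ENNReal)) (continuous_enorm.comp_continuousOn hF)
    continuousOn_const hU.measurableSet
  have e : (U.piecewise (fun w => ‖F w‖ₑ) fun _ => (0 : ENNReal)) = U.indicator fun w => ‖F w‖ₑ := by
    ext w
    simp [piecewise, indicator]
  rwa [e] at h

/-- Submean value property of the norm, integrated over a disc. -/
lemma enorm_mul_le_lintegral_ball [CompleteSpace E] {F : ℂ → E} {z : ℂ} {R : ℝ} (hR : 0 < R)
    (hd : DifferentiableOn ℂ F (Metric.ball z R)) :
    ENNReal.ofReal (R / 2) * ENNReal.ofReal (R / 2) * ‖F z‖ₑ ≤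
      ∫⁻ w in Metric.ball z R, ‖F w‖ₑ := by
  have hπ := Real.pi_pos
  set g : ℂ → ENNReal := (Metric.ball z R).indicator fun w => ‖F w‖ₑ with hg
  have hgm : Measurable g := measurable_indicator_enorm Metric.isOpen_ball hd.continuousOn
  -- Mean value property on the circle of radius `ρ`, with the factor `1 / 2π` weakened to `1`.
  have hcircle : ∀ ρ ∈ Ioo 0 R, ‖F z‖ₑ ≤
      ∫⁻ θ in Ioo (-Real.pi) Real.pi, ‖F (circleMap z ρ θ)‖ₑ := by
    rintro ρ ⟨h0, h1⟩
    have hdc : DiffContOnCl ℂ F (Metric.ball z |ρ|) := by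
      rw [abs_of_pos h0]
      refine DifferentiableOn.diffContOnCl ?_
      rw [closure_ball z h0.ne']
      exact hd.mono (Metric.closedBall_subset_ball h1)
    have h := hdc.circleAverage
    rw [Real.circleAverage_eq_integral_add (-Real.pi),
      intervalIntegral.integral_comp_add_right (fun θ => F (circleMap z ρ θ)), zero_add,
      show 2 * Real.pi + -Real.pi = Real.pi by ring,
      intervalIntegral.integral_of_le (by linarith), integral_Ioc_eq_integral_Ioo] at h
    rw [← h, enorm_smul]
    calc _ ≤ 1 * ‖∫ θ in Ioo (-Real.pi) Real.pi, F (circleMap z ρ θ)‖ₑ := by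
          gcongr
          rw [Real.enorm_of_nonneg (by positivity), ENNReal.ofReal_le_one]
          exact inv_le_one_of_one_le₀ (by linarith [Real.pi_gt_three])
      _ ≤ _ := by
          rw [one_mul]
          exact enorm_integral_le_lintegral_enorm _
  -- Only radii in `(R/2, R)` are kept: the interval has length `R/2` and the polar Jacobian is at
  -- least `R/2` on it.
  calc ENNReal.ofReal (R / 2) * ENNReal.ofReal (R / 2) * ‖F z‖ₑ
      = ∫⁻ _ρ in Ioo (R / 2) R, ENNReal.ofReal (R / 2) * ‖F z‖ₑ := by
        rw [setLIntegral_const, Real.volume_Ioo, show R - R / 2 = R / 2 by ring]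
        ring
    _ ≤ ∫⁻ ρ in Ioo (R / 2) R, ∫⁻ θ in Ioo (-Real.pi) Real.pi,
          ENNReal.ofReal ρ • g (z + Complex.polarCoord.symm (ρ, θ)) := by
        refine setLIntegral_mono' measurableSet_Ioo fun ρ hρ => ?_
        have h0 : 0 < ρ := by linarith [hρ.1]
        have e : ∀ θ : ℝ, g (z + Complex.polarCoord.symm (ρ, θ)) = ‖F (circleMap z ρ θ)‖ₑ := by
          intro θ
          have : z + Complex.polarCoord.symm (ρ, θ) = circleMap z ρ θ := by
            rw [Complex.polarCoord_symm_apply, circleMap, exp_mul_I]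
            simp
          rw [this, hg, indicator_of_mem]
          rw [Metric.mem_ball, dist_eq, circleMap_sub_center, norm_circleMap_zero, abs_of_pos h0]
          exact hρ.2
        simp_rw [e, smul_eq_mul]
        rw [lintegral_const_mul' _ _ ENNReal.ofReal_ne_top]
        gcongr
        · exact hρ.1.le
        · exact hcircle ρ ⟨h0, hρ.2⟩
    _ ≤ ∫⁻ ρ in Ioi 0, ∫⁻ θ in Ioo (-Real.pi) Real.pi,
          ENNReal.ofReal ρ • g (z + Complex.polarCoord.symm (ρ, θ)) :=
        lintegral_mono_set fun ρ hρ => (half_pos hR).trans hρ.1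
    _ = ∫⁻ p in _root_.polarCoord.target,
          ENNReal.ofReal p.1 • g (z + Complex.polarCoord.symm p) := by
        rw [polarCoord_target, Measure.volume_eq_prod, setLIntegral_prod]
        refine Measurable.aemeasurable ?_
        simp_rw [Complex.polarCoord_symm_apply]
        exact (ENNReal.measurable_ofReal.comp measurable_fst).smul (hgm.comp (by fun_prop))
    _ = ∫⁻ w, g (z + w) := Complex.lintegral_comp_polarCoord_symm fun w => g (z + w)
    _ = ∫⁻ w, g w := lintegral_add_left_eq_self g z
    _ = _ := lintegral_indicator Metric.isOpen_ball.measurableSet _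

/-- A function with uniformly square-integrable horizontal slices is bounded away from the
boundary. -/
lemma exists_bound_of_slices [CompleteSpace E] {F : ℂ → E} {D : NNReal}
    (hd : DifferentiableOn ℂ F {z | z.im < 0})
    (hD : ∀ y < (0 : ℝ), ∫⁻ x : ℝ, ‖F (x + y * I)‖ₑ ^ 2 ≤ D) {δ : ℝ} (hδ : 0 < δ) :
    ∃ M : ℝ, ∀ z : ℂ, z.im ≤ -δ → ‖F z‖ ≤ M := by
  have hc : ENNReal.ofReal (δ / 2) * ENNReal.ofReal (δ / 2) ≠ 0 := by
    simp [hδ]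
  -- The disc of radius `δ` lies in a square of side `2δ`. Since `‖F‖ ≤ 1 + ‖F‖²`, each horizontal
  -- slice contributes at most `2δ + D`, and the slices fill a height `2δ`.
  set T : ENNReal := (ENNReal.ofReal (2 * δ) + D) * ENNReal.ofReal (2 * δ) with hT
  have hTtop : T ≠ ⊤ := by
    rw [hT]
    exact ENNReal.mul_ne_top (ENNReal.add_ne_top.2 ⟨ENNReal.ofReal_ne_top, ENNReal.coe_ne_top⟩)
      ENNReal.ofReal_ne_top
  refine ⟨(T / (ENNReal.ofReal (δ / 2) * ENNReal.ofReal (δ / 2))).toReal, fun z hz => ?_⟩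
  have hball : Metric.ball z δ ⊆ {w : ℂ | w.im < 0} := by
    intro w hw
    have h1 := (abs_im_le_norm (w - z)).trans_lt (by simpa [dist_eq] using hw)
    rw [sub_im, abs_lt] at h1
    show w.im < 0
    linarith [h1.2]
  have h1 := enorm_mul_le_lintegral_ball hδ (hd.mono hball)
  set g : ℂ → ENNReal := (Metric.ball z δ).indicator fun w => ‖F w‖ₑ with hg
  have hgm : Measurable g := measurable_indicator_enorm Metric.isOpen_ball (hd.mono hball).continuousOn
  have h2 : ∫⁻ w in Metric.ball z δ, ‖F w‖ₑ ≤ T := by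
    calc ∫⁻ w in Metric.ball z δ, ‖F w‖ₑ = ∫⁻ w, g w :=
          (lintegral_indicator Metric.isOpen_ball.measurableSet _).symm
      _ = ∫⁻ p, g (measurableEquivRealProd.symm p) :=
          (volume_preserving_equiv_real_prod.symm.lintegral_comp hgm).symm
      _ = ∫⁻ y : ℝ, ∫⁻ x : ℝ, g (measurableEquivRealProd.symm (x, y)) := by
          rw [Measure.volume_eq_prod]
          exact lintegral_prod_symm' _ (hgm.comp measurableEquivRealProd.symm.measurable)
      _ ≤ ∫⁻ y : ℝ, (Ioo (z.im - δ) (z.im + δ)).indicator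
            (fun _ => ENNReal.ofReal (2 * δ) + D) y := by
          refine lintegral_mono fun y => ?_
          have hmem : ∀ x : ℝ, (⟨x, y⟩ : ℂ) ∈ Metric.ball z δ →
              x ∈ Ioo (z.re - δ) (z.re + δ) ∧ y ∈ Ioo (z.im - δ) (z.im + δ) := by
            intro x hx
            rw [Metric.mem_ball, dist_eq] at hx
            have a1 := (abs_re_le_norm _).trans_lt hx
            have a2 := (abs_im_le_norm _).trans_lt hx
            simp only [sub_re, sub_im, abs_lt] at a1 a2
            refine ⟨⟨?_, ?_⟩, ?_, ?_⟩ <;> linarith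
          by_cases hy : y ∈ Ioo (z.im - δ) (z.im + δ)
          · rw [indicator_of_mem hy]
            have hy0 : y < 0 := by linarith [hy.2]
            calc ∫⁻ x : ℝ, g (measurableEquivRealProd.symm (x, y))
                ≤ ∫⁻ x : ℝ, ((Ioo (z.re - δ) (z.re + δ)).indicator (fun _ => 1) x +
                    ‖F (x + y * I)‖ₑ ^ 2) := by
                  refine lintegral_mono fun x => ?_
                  rw [measurableEquivRealProd_symm_apply]
                  by_cases hb : (⟨x, y⟩ : ℂ) ∈ Metric.ball z δ
                  · rw [hg, indicator_of_mem hb, indicator_of_mem (hmem x hb).1, ← mk_eq_add_mul_I]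
                    rcases le_total ‖F ⟨x, y⟩‖ₑ 1 with h | h
                    · exact h.trans le_self_add
                    · refine le_trans ?_ le_add_self
                      exact le_self_pow₀ h (by norm_num)
                  · rw [hg, indicator_of_notMem hb]
                    exact zero_le
              _ = (∫⁻ x : ℝ, (Ioo (z.re - δ) (z.re + δ)).indicator (fun _ => 1) x) +
                    ∫⁻ x : ℝ, ‖F (x + y * I)‖ₑ ^ 2 :=
                  lintegral_add_left (measurable_const.indicator measurableSet_Ioo) _
              _ ≤ ENNReal.ofReal (2 * δ) + D := by
                  refine add_le_add (le_of_eq ?_) (hD y hy0)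
                  rw [lintegral_indicator measurableSet_Ioo, setLIntegral_one, Real.volume_Ioo]
                  congr 1; ring
          · rw [indicator_of_notMem hy]
            refine le_of_eq ?_
            rw [← lintegral_zero (μ := (volume : Measure ℝ))]
            refine lintegral_congr fun x => ?_
            rw [measurableEquivRealProd_symm_apply]
            exact indicator_of_notMem (fun hb => hy (hmem x hb).2) _
      _ = T := by
          rw [lintegral_indicator measurableSet_Ioo, setLIntegral_const, Real.volume_Ioo, hT]
          congr 2; ring
  have h3 : ‖F z‖ₑ ≤ T / (ENNReal.ofReal (δ / 2) * ENNReal.ofReal (δ / 2)) := by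
    rw [ENNReal.le_div_iff_mul_le (Or.inl hc) (Or.inl
      (ENNReal.mul_ne_top ENNReal.ofReal_ne_top ENNReal.ofReal_ne_top)), mul_comm]
    exact h1.trans h2
  have h4 := ENNReal.toReal_mono (ENNReal.div_ne_top hTtop hc) h3
  simpa using h4

end HardyBound

/-! ### Poisson representation by almost-everywhere boundary values. -/

section HardyBoundary

variable {E : Type*} [NormedAddCommGroup E] [NormedSpace ℂ E]

lemma integral_norm_sq_le_of_eLpNorm_le {E : Type*} [NormedAddCommGroup E] {g : ℝ → E} (hg : MemLp g 2 volume) {C : NNReal}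
    (hC : eLpNorm g 2 volume ≤ C) : ∫ x, ‖g x‖ ^ 2 ≤ (C : ℝ) ^ 2 := by
  have h1 := eLpNorm_nnreal_pow_eq_lintegral (f := g) (μ := volume) (p := 2) (by norm_num)
  have h2 : ∫⁻ x, ‖g x‖ₑ ^ 2 ≤ (C : ENNReal) ^ 2 := by
    have h3 : ∫⁻ x, ‖g x‖ₑ ^ 2 = eLpNorm g 2 volume ^ 2 := by
      simpa using h1.symm
    rw [h3]
    gcongr
  rw [integral_eq_lintegral_of_nonneg_ae (Eventually.of_forall fun x => sq_nonneg _)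
    (hg.integrable_norm_pow (by norm_num)).1]
  have h4 : ∀ x, ENNReal.ofReal (‖g x‖ ^ 2) = ‖g x‖ₑ ^ 2 := fun x => by
    rw [ENNReal.ofReal_pow (norm_nonneg _), ofReal_norm]
  simp_rw [h4]
  have := ENNReal.toReal_mono (by finiteness) h2
  simpa using this

lemma lintegral_enorm_sq_le_of_eLpNorm_le {E : Type*} [NormedAddCommGroup E] {g : ℝ → E} {C : NNReal}
    (hC : eLpNorm g 2 volume ≤ C) : ∫⁻ x, ‖g x‖ₑ ^ 2 ≤ ((C ^ 2 : NNReal) : ENNReal) := by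
  have h1 := eLpNorm_nnreal_pow_eq_lintegral (f := g) (μ := volume) (p := 2) (by norm_num)
  have h3 : ∫⁻ x, ‖g x‖ₑ ^ 2 = eLpNorm g 2 volume ^ 2 := by
    simpa using h1.symm
  rw [h3]
  push_cast
  gcongr

/-- Weak convergence: a sequence bounded in `L²` that converges almost everywhere converges when
integrated against a bounded integrable density. -/
lemma tendsto_integral_smul_of_bounded_sq {k : ℝ → ℝ} {κ D : ℝ} (hk : Integrable k)
    (hk0 : ∀ t, 0 ≤ k t) (hκ : ∀ t, k t ≤ κ) {g : ℕ → ℝ → E} {g' : ℝ → E}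
    (hg : ∀ n, MemLp (g n) 2 volume) (hg' : MemLp g' 2 volume)
    (hD : ∀ n, ∫ t, ‖g n t‖ ^ 2 ≤ D)
    (hlim : ∀ᵐ t, Tendsto (fun n => g n t) atTop (𝓝 (g' t))) :
    Tendsto (fun n => ∫ t, ((k t : ℝ) : ℂ) • g n t) atTop (𝓝 (∫ t, ((k t : ℝ) : ℂ) • g' t)) := by
  have hκ0 : 0 ≤ κ := (hk0 0).trans (hκ 0)
  -- Truncation at height `m`: where `‖h‖ > m`, `‖h‖ ≤ ‖h‖² / m`. The truncated part is handled by
  -- dominated convergence, and the tail is `O(1/m)` uniformly in `n` by the `L²` bound.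
  have key : ∀ (m : ℝ), 0 < m → ∀ h : ℝ → E, ∀ t : ℝ,
      k t * ‖h t‖ ≤ k t * min ‖h t‖ m + κ / m * ‖h t‖ ^ 2 := by
    intro m hm h t
    rcases le_total ‖h t‖ m with hle | hle
    · rw [min_eq_left hle]
      have : 0 ≤ κ / m * ‖h t‖ ^ 2 := by positivity
      linarith
    · have h1 : k t * ‖h t‖ ≤ κ / m * ‖h t‖ ^ 2 := by
        calc k t * ‖h t‖ ≤ κ * ‖h t‖ := mul_le_mul_of_nonneg_right (hκ t) (norm_nonneg _)
          _ = κ / m * (‖h t‖ * m) := by field_simp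
          _ ≤ κ / m * (‖h t‖ * ‖h t‖) := by gcongr
          _ = _ := by ring
      have : 0 ≤ k t * min ‖h t‖ m := mul_nonneg (hk0 t) (le_min (norm_nonneg _) hm.le)
      linarith
  have hmin : ∀ (m : ℝ), 0 < m → ∀ h : ℝ → E, AEStronglyMeasurable h →
      Integrable fun t => k t * min ‖h t‖ m := by
    intro m hm h hh
    refine (hk.mul_const m).mono' (hk.1.mul (hh.norm.inf aestronglyMeasurable_const))
      (Eventually.of_forall fun t => ?_)
    rw [Real.norm_of_nonneg (mul_nonneg (hk0 t) (le_min (norm_nonneg _) hm.le))]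
    exact mul_le_mul_of_nonneg_left (min_le_right _ _) (hk0 t)
  have hmaj : ∀ (m : ℝ), 0 < m → ∀ h : ℝ → E, MemLp h 2 volume →
      Integrable fun t => k t * min ‖h t‖ m + κ / m * ‖h t‖ ^ 2 := fun m hm h hh =>
    (hmin m hm h hh.1).add ((hh.integrable_norm_pow (by norm_num)).const_mul _)
  have hnorm : ∀ (h : ℝ → E) t, ‖((k t : ℝ) : ℂ) • h t‖ = k t * ‖h t‖ := fun h t => by
    rw [norm_smul, norm_real, Real.norm_of_nonneg (hk0 t)]
  have hint : ∀ h : ℝ → E, MemLp h 2 volume → Integrable fun t => ((k t : ℝ) : ℂ) • h t := by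
    intro h hh
    refine (hmaj 1 one_pos h hh).mono'
      ((continuous_ofReal.comp_aestronglyMeasurable hk.1).smul hh.1)
      (Eventually.of_forall fun t => ?_)
    rw [hnorm]
    exact key 1 one_pos h t
  set D' : ℝ := 2 * D + 2 * ∫ t, ‖g' t‖ ^ 2 with hD'
  have hsq : ∀ n, ∫ t, ‖g n t - g' t‖ ^ 2 ≤ D' := by
    intro n
    have i1 := (hg n).integrable_norm_pow (p := 2) (by norm_num)
    have i2 := hg'.integrable_norm_pow (p := 2) (by norm_num)
    have i3 := ((hg n).sub hg').integrable_norm_pow (p := 2) (by norm_num)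
    calc ∫ t, ‖g n t - g' t‖ ^ 2 ≤ ∫ t, (2 * ‖g n t‖ ^ 2 + 2 * ‖g' t‖ ^ 2) := by
          refine integral_mono i3 ((i1.const_mul 2).add (i2.const_mul 2)) fun t => ?_
          have := norm_sub_le (g n t) (g' t)
          nlinarith [norm_nonneg (g n t - g' t), sq_nonneg (‖g n t‖ - ‖g' t‖), norm_nonneg (g n t),
            norm_nonneg (g' t)]
      _ = 2 * (∫ t, ‖g n t‖ ^ 2) + 2 * ∫ t, ‖g' t‖ ^ 2 := by
          rw [integral_add (i1.const_mul 2) (i2.const_mul 2), integral_const_mul,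
            integral_const_mul]
      _ ≤ D' := by
          rw [hD']
          linarith [hD n]
  have hest : ∀ (m : ℝ), 0 < m → ∀ n,
      ‖(∫ t, ((k t : ℝ) : ℂ) • g n t) - ∫ t, ((k t : ℝ) : ℂ) • g' t‖ ≤
        (∫ t, k t * min ‖g n t - g' t‖ m) + κ / m * D' := by
    intro m hm n
    rw [← integral_sub (hint _ (hg n)) (hint _ hg')]
    simp_rw [← smul_sub]
    have hh : MemLp (fun t => g n t - g' t) 2 volume := (hg n).sub hg'
    refine (norm_integral_le_of_norm_le (hmaj m hm _ hh) (Eventually.of_forall fun t => ?_)).trans ?_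
    · rw [hnorm (fun t => g n t - g' t)]
      exact key m hm (fun t => g n t - g' t) t
    · rw [integral_add (hmin m hm _ hh.1) ((hh.integrable_norm_pow (by norm_num)).const_mul _),
        integral_const_mul]
      have : 0 ≤ κ / m := by positivity
      exact add_le_add_right (mul_le_mul_of_nonneg_left (hsq n) this) _
  have hdct : ∀ (m : ℝ), 0 < m →
      Tendsto (fun n => ∫ t, k t * min ‖g n t - g' t‖ m) atTop (𝓝 0) := by
    intro m hm
    have h0 : (0 : ℝ) = ∫ _ : ℝ, (0 : ℝ) := by simp
    rw [h0]
    refine tendsto_integral_of_dominated_convergence (fun t => k t * m)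
      (fun n => (hmin m hm _ ((hg n).sub hg').1).1) (hk.mul_const m)
      (fun n => Eventually.of_forall fun t => ?_) ?_
    · rw [Real.norm_of_nonneg (mul_nonneg (hk0 t) (le_min (norm_nonneg _) hm.le))]
      exact mul_le_mul_of_nonneg_left (min_le_right _ _) (hk0 t)
    · filter_upwards [hlim] with t ht
      have h1 : Tendsto (fun n => ‖g n t - g' t‖) atTop (𝓝 0) := by
        have := (ht.sub_const (g' t)).norm
        rwa [sub_self, norm_zero] at this
      have h2 := (h1.min (tendsto_const_nhds (x := m))).const_mul (k t)
      rwa [min_eq_left hm.le, mul_zero] at h2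
  rw [tendsto_iff_norm_sub_tendsto_zero, Metric.tendsto_atTop]
  intro ε hε
  have hD'0 : 0 ≤ D' := (integral_nonneg fun t => by positivity).trans (hsq 0)
  -- This choice puts the tail `κ D' / m` below `ε / 2`; the `+ 1` keeps `m` positive when `κ D' =
  -- 0`.
  set m : ℝ := 2 * (κ * D' + 1) / ε with hm
  have hm0 : 0 < m := by positivity
  have hsmall : κ / m * D' < ε / 2 := by
    rw [hm]
    field_simp
    linarith
  obtain ⟨n₀, hn₀⟩ := (Metric.tendsto_atTop.1 (hdct m hm0)) (ε / 2) (by positivity)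
  refine ⟨n₀, fun n hn => ?_⟩
  have h1 := hn₀ n hn
  rw [Real.dist_eq, sub_zero] at h1 ⊢
  rw [abs_of_nonneg (norm_nonneg _)]
  have := hest m hm0 n
  have := le_abs_self (∫ t, k t * min ‖g n t - g' t‖ m)
  linarith

lemma lowerPoisson_le {x y : ℝ} (hy : y < 0) (t : ℝ) :
    lowerPoisson x y t ≤ -y / Real.pi / y ^ 2 := by
  have h1 : 0 < -y := by linarith
  have h2 : 0 < y ^ 2 := by nlinarith
  have := Real.pi_pos
  unfold lowerPoisson
  gcongr
  nlinarith [sq_nonneg (t - x)]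

/-- Poisson representation of a Hardy function by its boundary values. -/
lemma eq_integral_lowerPoisson_boundary [CompleteSpace E] {F : ℂ → E} {f : ℝ → E} {C : NNReal}
    (hd : DifferentiableOn ℂ F {z | z.im < 0})
    (hmem : ∀ y < (0 : ℝ), MemLp (fun x : ℝ => F (x + y * I)) 2 volume)
    (hC : ∀ y < (0 : ℝ), eLpNorm (fun x : ℝ => F (x + y * I)) 2 volume ≤ C)
    (hb : ∀ᵐ x : ℝ, Tendsto (fun y : ℝ => F (x + y * I)) (𝓝[<] 0) (𝓝 (f x)))
    (hf : MemLp f 2 volume) (x : ℝ) {y : ℝ} (hy : y < 0) :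
    F (x + y * I) = ∫ t, ((lowerPoisson x y t : ℝ) : ℂ) • f t := by
  -- The translate by `-iδ` is holomorphic across the real axis and bounded on the closed
  -- half-plane, so the Poisson formula for bounded functions applies to it.
  have hshift : ∀ δ : ℝ, 0 < δ → F (x + (y - δ : ℝ) * I) =
      ∫ t, ((lowerPoisson x y t : ℝ) : ℂ) • F (t + (-δ : ℝ) * I) := by
    intro δ hδ
    obtain ⟨M, hM⟩ := exists_bound_of_slices hd
      (fun y hy => lintegral_enorm_sq_le_of_eLpNorm_le (hC y hy)) hδ
    have him : ∀ z : ℂ, (z + (-δ : ℝ) * I).im = z.im - δ := fun z => by simp [sub_eq_add_neg]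
    have hd' : DifferentiableOn ℂ (fun z => F (z + (-δ : ℝ) * I)) {z : ℂ | z.im < δ} := by
      refine hd.comp (by fun_prop) fun z hz => ?_
      change (z + (-δ : ℝ) * I).im < 0
      rw [him]
      exact sub_neg.2 hz
    have h := eq_integral_lowerPoisson (G := fun z => F (z + (-δ : ℝ) * I)) (M := M)
      (hd'.continuousOn.mono fun z hz => lt_of_le_of_lt hz hδ)
      (hd'.mono fun z hz => lt_trans hz hδ)
      (fun z hz => hM _ (by rw [him]; linarith)) x hy
    rw [← h]
    congr 1
    push_cast
    ring
  set δ : ℕ → ℝ := fun n => 1 / ((n : ℝ) + 1) with hδ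
  have hδ0 : ∀ n, 0 < δ n := fun n => Nat.one_div_pos_of_nat
  have hδlim : Tendsto δ atTop (𝓝 0) := tendsto_one_div_add_atTop_nhds_zero_nat
  have hneg : Tendsto (fun n => -δ n) atTop (𝓝[<] 0) := by
    refine tendsto_nhdsWithin_iff.2 ⟨by simpa using hδlim.neg, Eventually.of_forall fun n => ?_⟩
    exact neg_lt_zero.2 (hδ0 n)
  have h1 := tendsto_integral_smul_of_bounded_sq (integrable_lowerPoisson (x := x) hy)
    (lowerPoisson_nonneg hy) (lowerPoisson_le hy) (g := fun n t => F (t + (-δ n : ℝ) * I))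
    (fun n => hmem _ (neg_lt_zero.2 (hδ0 n))) hf
    (fun n => integral_norm_sq_le_of_eLpNorm_le (hmem _ (neg_lt_zero.2 (hδ0 n)))
      (hC _ (neg_lt_zero.2 (hδ0 n))))
    (by
      filter_upwards [hb] with t ht
      exact ht.comp hneg)
  have h2 : Tendsto (fun n => F (x + (y - δ n : ℝ) * I)) atTop (𝓝 (F (x + y * I))) := by
    have hca : ContinuousAt F (x + y * I) := by
      refine (hd.differentiableAt ?_).continuousAt
      exact (isOpen_lt continuous_im continuous_const).mem_nhds (by simpa using hy)
    refine hca.tendsto.comp ?_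
    have : Continuous fun s : ℝ => (x : ℂ) + (y - s : ℝ) * I := by fun_prop
    have := (this.tendsto 0).comp hδlim
    rwa [sub_zero] at this
  refine tendsto_nhds_unique h2 (h1.congr fun n => ?_)
  exact (hshift (δ n) (hδ0 n)).symm

end HardyBoundary

/-! ### From boundary decay to decay in the half-plane. -/

section RapidLower

variable {E : Type*} [NormedAddCommGroup E] [NormedSpace ℂ E]

/-- Functions holomorphic on the open lower half-plane, continuous up to the real axis, which
decay faster than any power in the closed half-plane. -/
structure IsRapidLower (B : ℂ → E) : Prop where
  cont : ContinuousOn B {z | z.im ≤ 0}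
  diff : DifferentiableOn ℂ B {z | z.im < 0}
  decay : ∀ n : ℕ, ∃ C : ℝ, ∀ z : ℂ, z.im ≤ 0 → (1 + ‖z‖) ^ n * ‖B z‖ ≤ C

/-- Phragmén–Lindelöf principle for bounded functions on the lower half-plane. -/
lemma norm_le_of_bounded_lower {G : ℂ → E} {M C : ℝ} (hc : ContinuousOn G {z | z.im ≤ 0})
    (hd : DifferentiableOn ℂ G {z | z.im < 0}) (hM : ∀ z : ℂ, z.im ≤ 0 → ‖G z‖ ≤ M)
    (hC : ∀ x : ℝ, ‖G x‖ ≤ C) {z : ℂ} (hz : z.im ≤ 0) : ‖G z‖ ≤ C := by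
  have him : ∀ w : ℂ, (-I * w).im = -w.re := fun w => by simp
  have hre : (I * z).re = -z.im := by simp
  -- The rotation `w ↦ -I w` carries the right half-plane to the lower one and the imaginary axis to
  -- the real axis.
  have h := PhragmenLindelof.right_half_plane_of_bounded_on_real (f := fun w => G (-I * w))
    (z := I * z) (C := C) ?_ ?_ ?_ ?_ (by rw [hre]; linarith)
  · have e : -I * (I * z) = z := by linear_combination (-z) * I_sq
    simpa only [e] using h
  · refine ⟨hd.comp (by fun_prop) fun w hw => ?_, ?_⟩
    · change (-I * w).im < 0
      rw [him]
      exact neg_lt_zero.2 hw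
    · rw [Complex.closure_setOfPred_lt_re]
      refine hc.comp (by fun_prop) fun w hw => ?_
      change (-I * w).im ≤ 0
      rw [him]
      exact neg_nonpos.2 hw
  · refine ⟨0, by norm_num, 0, ?_⟩
    refine IsBigO.of_bound M ?_
    rw [eventually_inf_principal]
    refine Eventually.of_forall fun w hw => ?_
    have hw' : 0 < w.re := hw
    simpa using hM (-I * w) (by rw [him]; linarith)
  · refine isBoundedUnder_of_eventually_le (a := M) ?_
    filter_upwards [eventually_ge_atTop 0] with x hx
    exact hM _ (by rw [him]; simpa using hx)
  · intro x
    have e : -I * ((x : ℂ) * I) = x := by linear_combination (-(x : ℂ)) * I_sq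
    rw [e]
    exact hC x

/-- Makes `(z - I) ^ n` a zero-free holomorphic substitute for the weight `(1 + ‖z‖) ^ n`, to which
Phragmén–Lindelöf can be applied. -/
lemma one_add_norm_le_two_mul_norm_sub_I {z : ℂ} (hz : z.im ≤ 0) : 1 + ‖z‖ ≤ 2 * ‖z - I‖ := by
  have h1 : 1 ≤ ‖z - I‖ := by
    refine le_trans ?_ (abs_im_le_norm _)
    rw [sub_im, I_im, abs_of_nonpos (by linarith)]
    linarith
  have h2 : ‖z‖ ≤ ‖z - I‖ := by
    refine abs_le_of_sq_le_sq' ?_ (norm_nonneg _) |>.2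
    rw [← normSq_eq_norm_sq, ← normSq_eq_norm_sq, normSq_apply, normSq_apply]
    simp only [sub_re, I_re, sub_im, I_im]
    nlinarith
  linarith

/-- A bounded holomorphic function on the lower half-plane with rapidly decreasing boundary
values is rapidly decreasing. -/
lemma isRapidLower_of_bounded {F : ℂ → E} {M : ℝ} (hc : ContinuousOn F {z | z.im ≤ 0})
    (hd : DifferentiableOn ℂ F {z | z.im < 0}) (hM : ∀ z : ℂ, z.im ≤ 0 → ‖F z‖ ≤ M)
    (hf : ∀ n : ℕ, ∃ C : ℝ, ∀ x : ℝ, (1 + ‖x‖) ^ n * ‖F x‖ ≤ C) : IsRapidLower F := by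
  refine ⟨hc, hd, fun n => ?_⟩
  obtain ⟨C, hC⟩ := hf n
  have hM0 : 0 ≤ M := (norm_nonneg _).trans (hM 0 (by simp))
  have hden : ∀ ε : ℝ, 0 ≤ ε → ∀ z : ℂ, z.im ≤ 0 → 1 ≤ ‖1 + I * ε * z‖ := by
    intro ε hε z hz
    refine le_trans ?_ (re_le_norm _)
    have : (1 + I * ε * z).re = 1 - ε * z.im := by simp [sub_eq_add_neg]
    rw [this]
    nlinarith
  have hden0 : ∀ ε : ℝ, 0 ≤ ε → ∀ z : ℂ, z.im ≤ 0 → 1 + I * ε * z ≠ 0 := fun ε hε z hz h => by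
    have := hden ε hε z hz
    rw [h, norm_zero] at this
    linarith
  -- The weight `(z - I) ^ n` alone could destroy the a priori boundedness. Dividing by `(1 + iεz) ^
  -- n` restores it, since `ε ≤ 1` gives a quotient of modulus at most `ε⁻¹`. The denominator has
  -- modulus at least `1`, so the bound `C` on the axis does not depend on `ε`, and `ε → 0` is
  -- allowed.
  have hest : ∀ ε ∈ Ioc (0 : ℝ) 1, ∀ z : ℂ, z.im ≤ 0 →
      ‖z - I‖ ^ n * ‖F z‖ ≤ C * ‖1 + I * ε * z‖ ^ n := by
    rintro ε ⟨h0, h1⟩ z hz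
    have hratio : ∀ z : ℂ, z.im ≤ 0 → ‖(z - I) / (1 + I * ε * z)‖ ≤ ε⁻¹ := by
      intro z hz
      rw [norm_div, div_le_iff₀ (by linarith [hden ε h0.le z hz])]
      have e : 1 + I * ε * z = (ε * I) * (z - I * (ε⁻¹ : ℝ)) := by
        have : (ε : ℂ) ≠ 0 := ofReal_ne_zero.2 h0.ne'
        push_cast
        field_simp
        linear_combination I_sq
      rw [e, norm_mul, norm_mul, norm_I, mul_one, norm_real, Real.norm_of_nonneg h0.le,
        inv_mul_cancel_left₀ h0.ne']
      refine abs_le_of_sq_le_sq' ?_ (norm_nonneg _) |>.2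
      rw [← normSq_eq_norm_sq, ← normSq_eq_norm_sq, normSq_apply, normSq_apply]
      have hi : 1 ≤ ε⁻¹ := (one_le_inv₀ h0).2 h1
      simp only [sub_re, I_re, sub_im, I_im, mul_re, mul_im, ofReal_re, ofReal_im]
      nlinarith
    have h := norm_le_of_bounded_lower
      (G := fun z => ((z - I) / (1 + I * ε * z)) ^ n • F z) (M := ε⁻¹ ^ n * M) (C := C) ?_ ?_ ?_ ?_ hz
    · rw [norm_smul, norm_pow, norm_div, div_pow, div_mul_eq_mul_div, div_le_iff₀] at h
      · exact h
      · have := hden ε h0.le z hz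
        positivity
    · exact ((ContinuousOn.div (by fun_prop) (by fun_prop) fun z hz => hden0 ε h0.le z hz).pow n).smul
        hc
    · exact ((DifferentiableOn.div (by fun_prop) (by fun_prop) fun z hz =>
        hden0 ε h0.le z (le_of_lt hz)).pow n).smul hd
    · intro z hz
      rw [norm_smul, norm_pow]
      gcongr
      · exact hratio z hz
      · exact hM z hz
    · intro x
      refine le_trans ?_ (hC x)
      rw [norm_smul, norm_pow]
      gcongr
      rw [norm_div]
      refine (div_le_self (norm_nonneg _) (hden ε h0.le x (by simp))).trans ?_
      refine (norm_sub_le _ _).trans ?_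
      rw [norm_I, norm_real, add_comm]
  refine ⟨2 ^ n * C, fun z hz => ?_⟩
  have hlim : Tendsto (fun ε : ℝ => C * ‖1 + I * ε * z‖ ^ n) (𝓝[>] 0) (𝓝 C) := by
    have hcont : Continuous fun ε : ℝ => C * ‖1 + I * ε * z‖ ^ n := by fun_prop
    have := hcont.tendsto 0
    simp only [ofReal_zero, mul_zero, zero_mul, add_zero, norm_one, one_pow, mul_one] at this
    exact this.mono_left nhdsWithin_le_nhds
  have h := ge_of_tendsto hlim (by
    filter_upwards [Ioc_mem_nhdsGT one_pos] with ε hε using hest ε hε z hz)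
  calc (1 + ‖z‖) ^ n * ‖F z‖ ≤ (2 * ‖z - I‖) ^ n * ‖F z‖ := by
        gcongr
        exact one_add_norm_le_two_mul_norm_sub_I hz
    _ = 2 ^ n * (‖z - I‖ ^ n * ‖F z‖) := by ring
    _ ≤ 2 ^ n * C := by gcongr

/-- A Hardy function on the lower half-plane with continuous, rapidly decreasing boundary values
is continuous up to the boundary and rapidly decreasing. -/
lemma isRapidLower_of_hardy [CompleteSpace E] {F : ℂ → E} {C : NNReal}
    (hd : DifferentiableOn ℂ F {z | z.im < 0})
    (hmem : ∀ y < (0 : ℝ), MemLp (fun x : ℝ => F (x + y * I)) 2 volume)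
    (hC : ∀ y < (0 : ℝ), eLpNorm (fun x : ℝ => F (x + y * I)) 2 volume ≤ C)
    (hb : ∀ᵐ x : ℝ, Tendsto (fun y : ℝ => F (x + y * I)) (𝓝[<] 0) (𝓝 (F x)))
    (hfc : Continuous fun x : ℝ => F x) (hf2 : MemLp (fun x : ℝ => F x) 2 volume)
    (hf : ∀ n : ℕ, ∃ C : ℝ, ∀ x : ℝ, (1 + ‖x‖) ^ n * ‖F x‖ ≤ C) : IsRapidLower F := by
  have hπ := Real.pi_pos
  obtain ⟨M, hM⟩ := hf 0
  simp only [pow_zero, one_mul] at hM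
  have hp : Integrable fun u : ℝ => Real.pi⁻¹ * (1 + u ^ 2)⁻¹ :=
    integrable_inv_one_add_sq.const_mul _
  have hp1 : ∫ u : ℝ, Real.pi⁻¹ * (1 + u ^ 2)⁻¹ = 1 := by
    rw [integral_const_mul, integral_univ_inv_one_add_sq, inv_mul_cancel₀ hπ.ne']
  have hp0 : ∀ u : ℝ, 0 ≤ Real.pi⁻¹ * (1 + u ^ 2)⁻¹ := fun u => by positivity
  have hpc : Continuous fun u : ℝ => Real.pi⁻¹ * (1 + u ^ 2)⁻¹ :=
    continuous_const.mul (Continuous.inv₀ (by fun_prop) fun u => by positivity)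
  -- The rescaled Poisson integral is defined and continuous on all of `ℂ`, with the dominating
  -- function `M` times the density. It agrees with `F` inside by the Poisson formula, and on the
  -- axis because the density has mass `1`.
  set P : ℂ → E := fun z => ∫ u : ℝ, ((Real.pi⁻¹ * (1 + u ^ 2)⁻¹ : ℝ) : ℂ) •
    F ((z.re + z.im * u : ℝ) : ℂ) with hP
  have hbound : ∀ (z : ℂ) (u : ℝ), ‖((Real.pi⁻¹ * (1 + u ^ 2)⁻¹ : ℝ) : ℂ) •
      F ((z.re + z.im * u : ℝ) : ℂ)‖ ≤ Real.pi⁻¹ * (1 + u ^ 2)⁻¹ * M := fun z u => by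
    rw [norm_smul, norm_real, Real.norm_of_nonneg (hp0 u)]
    exact mul_le_mul_of_nonneg_left (hM _) (hp0 u)
  have hPc : Continuous P := by
    refine continuous_of_dominated (bound := fun u => Real.pi⁻¹ * (1 + u ^ 2)⁻¹ * M)
      (fun z => ?_) (fun z => Eventually.of_forall (hbound z)) (hp.mul_const M)
      (Eventually.of_forall fun u => ?_)
    · exact ((continuous_ofReal.comp hpc).smul (hfc.comp (by fun_prop :
        Continuous fun u : ℝ => z.re + z.im * u))).aestronglyMeasurable
    · exact continuous_const.smul (hfc.comp (by fun_prop :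
        Continuous fun z : ℂ => z.re + z.im * u))
  have hFP : ∀ z : ℂ, z.im ≤ 0 → F z = P z := by
    intro z hz
    rcases hz.lt_or_eq with hz | hz
    · have h1 := eq_integral_lowerPoisson_boundary hd hmem hC hb hf2 z.re hz
      rw [integral_lowerPoisson_smul hz, re_add_im] at h1
      exact h1
    · have e : z = (z.re : ℂ) := by apply Complex.ext <;> simp [hz]
      simp only [hP, hz, zero_mul, add_zero]
      rw [integral_smul_const, integral_complex_ofReal, hp1, ofReal_one, one_smul, ← e]
  have hbd : ∀ z : ℂ, z.im ≤ 0 → ‖F z‖ ≤ M := by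
    intro z hz
    rw [hFP z hz]
    refine (norm_integral_le_of_norm_le (hp.mul_const M) (Eventually.of_forall (hbound z))).trans ?_
    rw [integral_mul_const, hp1, one_mul]
  exact isRapidLower_of_bounded (hPc.continuousOn.congr hFP) hd hbd hf

end RapidLower

/-! ### Hardy extensions of Schwartz functions. -/

section Schwartz

variable {K : Type*} [NormedAddCommGroup K] [InnerProductSpace ℂ K]

lemma SchwartzMap.exists_one_add_norm_pow_mul_le (f : 𝓢(ℝ, K)) (n : ℕ) :
    ∃ C : ℝ, ∀ x : ℝ, (1 + ‖x‖) ^ n * ‖f x‖ ≤ C := by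
  refine ⟨2 ^ n * (Finset.Iic (n, 0)).sup (fun m => SchwartzMap.seminorm ℝ m.1 m.2) f, fun x => ?_⟩
  have := SchwartzMap.one_add_le_sup_seminorm_apply (𝕜 := ℝ) (m := (n, 0)) (k := n) (n := 0)
    le_rfl le_rfl f x
  simpa using this

lemma IsHardyExtension.isRapidLower [CompleteSpace K] {φ : 𝓢(ℝ, K)} {Φ : ℂ → K}
    (h : IsHardyExtension (Iio 0) φ Φ) : IsRapidLower Φ := by
  obtain ⟨C, hC⟩ := h.hardy.bounded
  have e : (fun x : ℝ => Φ x) = φ := funext h.on_real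
  refine isRapidLower_of_hardy h.hardy.analytic h.hardy.memLp hC ?_ (e ▸ φ.continuous)
    (e ▸ φ.memLp 2 volume) fun n => ?_
  · filter_upwards [h.boundary] with x hx
    rwa [h.on_real]
  · obtain ⟨C, hC⟩ := SchwartzMap.exists_one_add_norm_pow_mul_le φ n
    exact ⟨C, fun x => by rw [h.on_real]; exact hC x⟩

/-- The reflection `z ↦ -z` exchanges the half-planes and preserves holomorphy, so the upper Hardy
class inherits the theory of the lower one. -/
lemma IsHardyExtension.isRapidLower_neg [CompleteSpace K] {ψ : 𝓢(ℝ, K)} {Ψ : ℂ → K}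
    (h : IsHardyExtension (Ioi 0) ψ Ψ) : IsRapidLower fun z => Ψ (-z) := by
  obtain ⟨C, hC⟩ := h.hardy.bounded
  have hneg : MeasurePreserving (fun x : ℝ => -x) volume volume := Measure.measurePreserving_neg _
  have e : (fun x : ℝ => Ψ (-(x : ℂ))) = fun x => ψ (-x) := funext fun x => by
    rw [← ofReal_neg, h.on_real]
  have e2 : ∀ y : ℝ, (fun x : ℝ => Ψ (-((x : ℂ) + y * I))) =
      (fun x : ℝ => Ψ ((x : ℂ) + (-y : ℝ) * I)) ∘ fun x => -x := fun y => by
    ext x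
    simp only [Function.comp]
    congr 1
    push_cast
    ring
  refine isRapidLower_of_hardy (C := C) ?_ (fun y hy => ?_) (fun y hy => ?_) ?_ ?_ ?_ fun n => ?_
  · refine h.hardy.analytic.comp (by fun_prop) fun z hz => ?_
    change 0 < (-z).im
    rw [neg_im]
    exact neg_pos.2 hz
  · rw [e2]
    exact (h.hardy.memLp (-y) (neg_pos.2 hy)).comp_measurePreserving hneg
  · rw [e2, eLpNorm_comp_measurePreserving (h.hardy.memLp (-y) (neg_pos.2 hy)).1 hneg]
    exact hC (-y) (neg_pos.2 hy)
  · have hb := hneg.quasiMeasurePreserving.ae h.boundary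
    filter_upwards [hb] with x hx
    have ht : Tendsto (fun y : ℝ => -y) (𝓝[<] 0) (𝓝[>] 0) := by
      refine tendsto_nhdsWithin_iff.2 ⟨?_, ?_⟩
      · exact (by simpa using (continuous_neg (G := ℝ)).tendsto 0 :
          Tendsto (fun y : ℝ => -y) (𝓝 0) (𝓝 0)).mono_left nhdsWithin_le_nhds
      · filter_upwards [self_mem_nhdsWithin] with y hy using neg_pos.2 (mem_Iio.1 hy)
    have h1 := hx.comp ht
    rw [congrFun e x]
    refine h1.congr fun y => ?_
    exact (congrFun (e2 y) x).symm
  · rw [e]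
    exact ψ.continuous.comp continuous_neg
  · rw [e]
    exact (ψ.memLp 2 volume).comp_measurePreserving hneg
  · obtain ⟨C, hC⟩ := SchwartzMap.exists_one_add_norm_pow_mul_le ψ n
    refine ⟨C, fun x => ?_⟩
    rw [congrFun e x]
    simpa using hC (-x)

end Schwartz

/-! ### Holomorphy and decay of the bracket. -/

section BraKet

variable {K : Type*} [NormedAddCommGroup K] [InnerProductSpace ℂ K]

/-- The conjugation of the argument and the antilinearity of the first slot cancel. At the level of
slopes, conjugating `(-conj z + conj s)⁻¹` gives `-(z - s)⁻¹`, whence the sign of the first term of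
the derivative. -/
lemma differentiableOn_inner_neg_conj {A Φ : ℂ → K} (hA : DifferentiableOn ℂ A {z | z.im < 0})
    (hΦ : DifferentiableOn ℂ Φ {z | z.im < 0}) :
    DifferentiableOn ℂ (fun s => inner ℂ (A (-conj s)) (Φ s)) {z | z.im < 0} := by
  have hopen : IsOpen {z : ℂ | z.im < 0} := isOpen_lt continuous_im continuous_const
  intro s hs
  have hs' : (-conj s) ∈ {z : ℂ | z.im < 0} := by
    change (-conj s).im < 0
    rw [neg_im, conj_im, neg_neg]
    exact hs
  have h1 := (hA.differentiableAt (hopen.mem_nhds hs')).hasDerivAt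
  have h2 := (hΦ.differentiableAt (hopen.mem_nhds hs)).hasDerivAt
  have hinv : Tendsto (fun z : ℂ => -conj z) (𝓝[≠] s) (𝓝[≠] (-conj s)) := by
    refine tendsto_nhdsWithin_iff.2 ⟨?_, ?_⟩
    · exact (continuous_conj.neg.tendsto s).mono_left nhdsWithin_le_nhds
    · filter_upwards [self_mem_nhdsWithin] with z hz h
      exact hz ((starRingEnd ℂ).injective (neg_injective h))
  have t1 := (hasDerivAt_iff_tendsto_slope.1 h1).comp hinv
  have t2 := hasDerivAt_iff_tendsto_slope.1 h2
  have t3 : Tendsto Φ (𝓝[≠] s) (𝓝 (Φ s)) := h2.continuousAt.tendsto.mono_left nhdsWithin_le_nhds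
  have t4 := (Tendsto.inner (𝕜 := ℂ) t1 t3).neg.add
    (Tendsto.inner (𝕜 := ℂ) (tendsto_const_nhds (x := A (-conj s))) t2)
  have h : HasDerivAt (fun s => inner ℂ (A (-conj s)) (Φ s))
      (-inner ℂ (deriv A (-conj s)) (Φ s) + inner ℂ (A (-conj s)) (deriv Φ s)) s := by
    refine hasDerivAt_iff_tendsto_slope.2 (t4.congr' ?_)
    filter_upwards [self_mem_nhdsWithin] with z hz
    have hz' : z - s ≠ 0 := sub_ne_zero.2 hz
    simp only [Function.comp, slope_def_module, inner_smul_left, inner_smul_right, inner_sub_left,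
      inner_sub_right, smul_eq_mul]
    have : conj ((-conj z - -conj s)⁻¹) = -(z - s)⁻¹ := by
      simp only [map_inv₀, map_sub, map_neg, conj_conj]
      rw [← inv_neg]
      congr 1
      ring
    rw [this]
    ring
  exact h.differentiableAt.differentiableWithinAt

/-- Pairing a rapidly decreasing reflected function with a bounded one. -/
lemma IsRapidLower.inner_neg_conj {A Φ : ℂ → K} {M : ℝ} (hA : IsRapidLower A)
    (hc : ContinuousOn Φ {z | z.im ≤ 0}) (hd : DifferentiableOn ℂ Φ {z | z.im < 0})
    (hM : ∀ z : ℂ, z.im ≤ 0 → ‖Φ z‖ ≤ M) :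
    IsRapidLower fun s => inner ℂ (A (-conj s)) (Φ s) := by
  have hmap : ∀ z : ℂ, z.im ≤ 0 → (-conj z).im ≤ 0 := fun z hz => by simpa using hz
  have hM0 : 0 ≤ M := (norm_nonneg _).trans (hM 0 (by simp))
  refine ⟨?_, differentiableOn_inner_neg_conj hA.diff hd, fun n => ?_⟩
  · exact (hA.cont.comp continuous_conj.neg.continuousOn hmap).inner hc
  · obtain ⟨C, hC⟩ := hA.decay n
    refine ⟨C * M, fun z hz => ?_⟩
    have h1 := hC _ (hmap z hz)
    rw [norm_neg, norm_conj] at h1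
    calc (1 + ‖z‖) ^ n * ‖inner ℂ (A (-conj z)) (Φ z)‖
        ≤ (1 + ‖z‖) ^ n * (‖A (-conj z)‖ * ‖Φ z‖) := by
          gcongr
          exact norm_inner_le_norm _ _
      _ = ((1 + ‖z‖) ^ n * ‖A (-conj z)‖) * ‖Φ z‖ := by ring
      _ ≤ C * M := mul_le_mul h1 (hM z hz) (norm_nonneg _)
          ((by positivity : (0 : ℝ) ≤ (1 + ‖z‖) ^ n * ‖A (-conj z)‖).trans h1)

lemma isRapidLower_braKet [CompleteSpace K] {ψ φ : 𝓢(ℝ, K)} {Ψ Φ : ℂ → K}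
    (hΨ : IsHardyExtension (Ioi 0) ψ Ψ) (hΦ : IsHardyExtension (Iio 0) φ Φ) :
    IsRapidLower (braKet Ψ Φ) := by
  obtain ⟨M, hM⟩ := hΦ.isRapidLower.decay 0
  simp only [pow_zero, one_mul] at hM
  have := hΨ.isRapidLower_neg.inner_neg_conj hΦ.isRapidLower.cont hΦ.isRapidLower.diff hM
  simpa only [neg_neg] using! this

/-- A constant vector does not decay, but the pairing needs only boundedness of its second factor.
This is the version used for Gamow kets. -/
lemma isRapidLower_braKet_const [CompleteSpace K] {ψ : 𝓢(ℝ, K)} {Ψ : ℂ → K}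
    (hΨ : IsHardyExtension (Ioi 0) ψ Ψ) (k : K) : IsRapidLower (braKet Ψ fun _ => k) := by
  have := hΨ.isRapidLower_neg.inner_neg_conj (Φ := fun _ => k) continuousOn_const
    (differentiableOn_const k) (M := ‖k‖) fun _ _ => le_rfl
  simpa only [neg_neg] using! this

lemma braKet_ofReal {ψ φ : 𝓢(ℝ, K)} {Ψ Φ : ℂ → K} {Y Y' : Set ℝ}
    (hΨ : IsHardyExtension Y ψ Ψ) (hΦ : IsHardyExtension Y' φ Φ) (s : ℝ) :
    braKet Ψ Φ s = inner ℂ (ψ s) (φ s) := by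
  rw [braKet, conj_ofReal, hΨ.on_real, hΦ.on_real]

end BraKet

/-! ### Wave functions are determined above threshold. -/

section Uniqueness

variable {E : Type*} [NormedAddCommGroup E] [NormedSpace ℂ E]

/-- A bounded holomorphic function on the lower half-plane whose boundary values vanish on a ray
vanishes. -/
lemma eq_zero_of_eq_zero_on_ray {F : ℂ → E} {M s₀ : ℝ} (hc : ContinuousOn F {z | z.im ≤ 0})
    (hd : DifferentiableOn ℂ F {z | z.im < 0}) (hM : ∀ z : ℂ, z.im ≤ 0 → ‖F z‖ ≤ M)
    (h0 : ∀ x : ℝ, s₀ ≤ x → F x = 0) {z : ℂ} (hz : z.im < 0) : F z = 0 := by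
  have hπ := Real.pi_pos
  have hM0 : 0 ≤ M := (norm_nonneg _).trans (hM 0 (by simp))
  have him : ∀ w : ℂ, (s₀ + exp w).im = Real.exp w.re * Real.sin w.im := fun w => by
    simp [exp_im]
  have hstrip : ∀ w : ℂ, -Real.pi ≤ w.im → w.im ≤ 0 → (s₀ + exp w).im ≤ 0 := fun w h1 h2 => by
    rw [him]
    exact mul_nonpos_of_nonneg_of_nonpos (Real.exp_pos _).le
      (Real.sin_nonpos_of_nonpos_of_neg_pi_le h2 h1)
  have hnorm : ∀ (n : ℕ) (w : ℂ), ‖exp (-(n * w * I))‖ = Real.exp (n * w.im) := fun n w => by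
    rw [norm_exp]
    congr 1
    simp
  -- Under `z = s₀ + exp w` the half-plane becomes the strip `-π < im w < 0`, and the edge `im w =
  -- 0` is the ray where `F` vanishes. The factor has modulus `exp (n im w)`, hence `exp (-nπ)` on
  -- the other edge. At an interior point this gives `‖F z‖ ≤ exp (-n (π + im w)) M`, which tends to
  -- `0`.
  have hest : ∀ (n : ℕ) (w : ℂ), -Real.pi ≤ w.im → w.im ≤ 0 →
      ‖exp (-(n * w * I)) • F (s₀ + exp w)‖ ≤ Real.exp (-(n * Real.pi)) * M := by
    intro n w hw1 hw2
    refine PhragmenLindelof.horizontal_strip (a := -Real.pi) (b := 0)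
      (f := fun w => exp (-(n * w * I)) • F (s₀ + exp w)) ⟨?_, ?_⟩ ?_ ?_ ?_ hw1 hw2
    · refine DifferentiableOn.smul (by fun_prop) (hd.comp (by fun_prop) fun w hw => ?_)
      change (s₀ + exp w).im < 0
      rw [him]
      exact mul_neg_of_pos_of_neg (Real.exp_pos _) (Real.sin_neg_of_neg_of_neg_pi_lt hw.2 hw.1)
    · have hcl : closure (im ⁻¹' Ioo (-Real.pi) 0) ⊆ im ⁻¹' Icc (-Real.pi) 0 :=
        closure_minimal (preimage_mono Ioo_subset_Icc_self) (isClosed_Icc.preimage continuous_im)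
      refine ContinuousOn.mono ?_ hcl
      exact ContinuousOn.smul (by fun_prop) (hc.comp (by fun_prop) fun w hw =>
        hstrip w hw.1 hw.2)
    · refine ⟨0, by rw [sub_neg_eq_add, zero_add, div_self hπ.ne']; exact one_pos, 0, ?_⟩
      refine IsBigO.of_bound M ?_
      rw [eventually_inf_principal]
      refine Eventually.of_forall fun w hw => ?_
      rw [norm_smul, hnorm, zero_mul, Real.exp_zero, norm_one, mul_one]
      refine (mul_le_of_le_one_left (norm_nonneg _) ?_).trans (hM _ (hstrip w hw.1.le hw.2.le))
      rw [Real.exp_le_one_iff]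
      exact mul_nonpos_of_nonneg_of_nonpos (Nat.cast_nonneg n) hw.2.le
    · intro w hw
      rw [norm_smul, hnorm, hw, mul_neg]
      exact mul_le_mul_of_nonneg_left (hM _ (hstrip w hw.ge (by linarith))) (Real.exp_pos _).le
    · intro w hw
      have e : (s₀ : ℂ) + exp w = ((s₀ + Real.exp w.re : ℝ) : ℂ) := by
        have : w = w.re := by apply Complex.ext <;> simp [hw]
        rw [this]
        push_cast
        simp
      rw [e, h0 _ (by linarith [Real.exp_pos w.re]), smul_zero, norm_zero]
      positivity
  have hne : z - s₀ ≠ 0 := fun h => by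
    have := congrArg im h
    simp at this
    exact hz.ne this
  set w := log (z - s₀) with hw
  have hargim : w.im = arg (z - s₀) := log_im _
  have hw1 : -Real.pi < w.im := by rw [hargim]; exact neg_pi_lt_arg _
  have hw2 : w.im ≤ 0 := by
    rw [hargim]
    exact (arg_neg_iff.2 (by simpa using hz)).le
  have hzw : (s₀ : ℂ) + exp w = z := by rw [hw, exp_log hne]; ring
  have hfin : ∀ n : ℕ, ‖F z‖ ≤ Real.exp (-(Real.pi + w.im)) ^ n * M := by
    intro n
    have := hest n w hw1.le hw2
    rw [norm_smul, hnorm, hzw] at this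
    rw [← Real.exp_nat_mul]
    calc ‖F z‖ = Real.exp (-(n * w.im)) * (Real.exp (n * w.im) * ‖F z‖) := by
          rw [← mul_assoc, ← Real.exp_add]
          simp
      _ ≤ Real.exp (-(n * w.im)) * (Real.exp (-(n * Real.pi)) * M) := by gcongr
      _ = _ := by
          rw [← mul_assoc, ← Real.exp_add]
          congr 2
          ring
  have hlim : Tendsto (fun n : ℕ => Real.exp (-(Real.pi + w.im)) ^ n * M) atTop (𝓝 0) := by
    have := (tendsto_pow_atTop_nhds_zero_of_lt_one (Real.exp_pos _).le
      (Real.exp_lt_one_iff.2 (by linarith : -(Real.pi + w.im) < 0))).mul_const M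
    rwa [zero_mul] at this
  exact norm_le_zero_iff.1 (ge_of_tendsto hlim (Eventually.of_forall hfin))

/-- The boundary values vanish as well. -/
lemma eq_zero_of_eq_zero_on_ray_real {F : ℂ → E} {M s₀ : ℝ} (hc : ContinuousOn F {z | z.im ≤ 0})
    (hd : DifferentiableOn ℂ F {z | z.im < 0}) (hM : ∀ z : ℂ, z.im ≤ 0 → ‖F z‖ ≤ M)
    (h0 : ∀ x : ℝ, s₀ ≤ x → F x = 0) (x : ℝ) : F x = 0 := by
  have ht : Tendsto (fun y : ℝ => (x : ℂ) + y * I) (𝓝[<] 0) (𝓝[{z : ℂ | z.im ≤ 0}] x) := by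
    refine tendsto_nhdsWithin_iff.2 ⟨?_, ?_⟩
    · have : Continuous fun y : ℝ => (x : ℂ) + y * I := by fun_prop
      have := this.tendsto 0
      simp only [ofReal_zero, zero_mul, add_zero] at this
      exact this.mono_left nhdsWithin_le_nhds
    · filter_upwards [self_mem_nhdsWithin] with y hy
      have hy' : y < 0 := hy
      simpa using hy'.le
  have h1 := (hc x (by simp)).tendsto.comp ht
  refine tendsto_nhds_unique h1 (tendsto_const_nhds.congr' ?_)
  filter_upwards [self_mem_nhdsWithin] with y hy
  have hy' : y < 0 := hy
  exact (eq_zero_of_eq_zero_on_ray hc hd hM h0 (by simpa using hy')).symm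

variable {K : Type*} [NormedAddCommGroup K] [InnerProductSpace ℂ K] [CompleteSpace K]

lemma inSpace_injective_restrict (s₀ : ℝ) :
    Function.Injective fun (f : inSpace K) (s : Ici s₀) => (f : 𝓢(ℝ, K)) (s : ℝ) := by
  intro f g hfg
  obtain ⟨-, F, hF⟩ := (f - g).2
  have hR := hF.isRapidLower
  obtain ⟨M, hM⟩ := hR.decay 0
  simp only [pow_zero, one_mul] at hM
  have h := eq_zero_of_eq_zero_on_ray_real (s₀ := s₀) hR.cont hR.diff hM fun x hx => by
    rw [hF.on_real]
    have := congrFun hfg ⟨x, hx⟩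
    simpa [sub_eq_zero] using this
  ext x
  have := h x
  rw [hF.on_real] at this
  simpa [sub_eq_zero] using this

lemma outSpace_injective_restrict (s₀ : ℝ) :
    Function.Injective fun (f : outSpace K) (s : Ici s₀) => (f : 𝓢(ℝ, K)) (s : ℝ) := by
  intro f g hfg
  obtain ⟨-, F, hF⟩ := (f - g).2
  ext x
  -- The reflection `z ↦ -z` would move the ray. Pairing with the fixed vector `F x` reaches the
  -- lower half-plane by conjugation instead, which fixes the real axis; the value at `x` is then
  -- `⟪F x, F x⟫`.
  have hR := isRapidLower_braKet_const hF (F x)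
  obtain ⟨M, hM⟩ := hR.decay 0
  simp only [pow_zero, one_mul] at hM
  have h := eq_zero_of_eq_zero_on_ray_real (s₀ := s₀) hR.cont hR.diff hM (fun y hy => by
    have h1 := congrFun hfg ⟨y, hy⟩
    have h2 : F y = 0 := by
      rw [hF.on_real]
      simpa [sub_eq_zero] using h1
    rw [braKet, conj_ofReal, h2, inner_zero_left]) x
  rw [braKet, conj_ofReal, inner_self_eq_zero, hF.on_real] at h
  simpa [sub_eq_zero] using h

end Uniqueness

/-! ### Arc estimates and Cauchy's formula on the real line. -/

section LineIntegral

lemma IsRapidLower.continuous_ofReal {E : Type*} [NormedAddCommGroup E] [NormedSpace ℂ E]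
    {B : ℂ → E} (hB : IsRapidLower B) : Continuous fun x : ℝ => B x :=
  continuousOn_univ.1 (hB.cont.comp Complex.continuous_ofReal.continuousOn fun x _ => by simp)

lemma IsRapidLower.integrable {E : Type*} [NormedAddCommGroup E] [NormedSpace ℂ E]
    {B : ℂ → E} (hB : IsRapidLower B) : Integrable fun x : ℝ => B x := by
  obtain ⟨C, hC⟩ := hB.decay 2
  refine (integrable_inv_one_add_sq.const_mul C).mono' hB.continuous_ofReal.aestronglyMeasurable
    (Eventually.of_forall fun x => ?_)
  have h1 := hC x (by simp)
  rw [← div_eq_mul_inv, le_div_iff₀ (by positivity), mul_comm]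
  refine le_trans ?_ h1
  gcongr
  rw [norm_real, Real.norm_eq_abs]
  nlinarith [abs_nonneg x, sq_abs x]

lemma ofReal_sub_ne_zero {a : ℂ} (ha : a.im < 0) (x : ℝ) : (x : ℂ) - a ≠ 0 := fun h => by
  have := congrArg im h
  simp only [sub_im, ofReal_im, zero_im] at this
  linarith

lemma continuous_inv_ofReal_sub {a : ℂ} (ha : a.im < 0) :
    Continuous fun x : ℝ => ((x : ℂ) - a)⁻¹ :=
  (Complex.continuous_ofReal.sub continuous_const).inv₀ (ofReal_sub_ne_zero ha)

lemma norm_inv_ofReal_sub_le {a : ℂ} (ha : a.im < 0) (x : ℝ) : ‖((x : ℂ) - a)⁻¹‖ ≤ (-a.im)⁻¹ := by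
  rw [norm_inv]
  refine inv_anti₀ (by linarith) ?_
  have := abs_im_le_norm ((x : ℂ) - a)
  rw [sub_im, ofReal_im, zero_sub, abs_of_pos (by linarith)] at this
  exact this

lemma integrable_inv_sub_mul {a : ℂ} (ha : a.im < 0) {g : ℝ → ℂ} (hg : Integrable g) :
    Integrable fun x : ℝ => ((x : ℂ) - a)⁻¹ * g x :=
  hg.bdd_mul (continuous_inv_ofReal_sub ha).aestronglyMeasurable
    (Eventually.of_forall (norm_inv_ofReal_sub_le ha))

/-- Quadratic decay beats the arc length `π r`. The bound is asked only for `‖z‖ ≥ r₀`, which leaves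
room for poles. -/
lemma tendsto_semicircleAbsIntegral {f : ℂ → ℂ} {C r₀ : ℝ}
    (h : ∀ z : ℂ, z.im ≤ 0 → r₀ ≤ ‖z‖ → (1 + ‖z‖) ^ 2 * ‖f z‖ ≤ C) :
    Tendsto (semicircleAbsIntegral f) atTop (𝓝 0) := by
  have hπ := Real.pi_pos
  have hz : Tendsto (fun r : ℝ => C * r⁻¹ * Real.pi) atTop (𝓝 0) := by
    simpa using (tendsto_inv_atTop_zero.const_mul C).mul_const Real.pi
  refine squeeze_zero_norm' ?_ hz
  filter_upwards [eventually_ge_atTop r₀, eventually_gt_atTop 0] with r hr hr0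
  have : ‖semicircleAbsIntegral f r‖ ≤ C * r⁻¹ * |0 - -Real.pi| := by
    refine intervalIntegral.norm_integral_le_of_norm_le_const fun θ hθ => ?_
    rw [uIoc_of_le (by linarith)] at hθ
    have hn : ‖circleMap 0 r θ‖ = r := by rw [norm_circleMap_zero, abs_of_pos hr0]
    have h1 := h _ (circleMap_im_nonpos hr0.le hθ.1.le hθ.2) (hn.symm ▸ hr)
    rw [hn] at h1
    rw [norm_mul, norm_norm, Real.norm_of_nonneg hr0.le, ← div_eq_mul_inv, le_div_iff₀ hr0]
    refine le_trans ?_ h1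
    nlinarith [norm_nonneg (f (circleMap 0 r θ)), mul_nonneg hr0.le
      (norm_nonneg (f (circleMap 0 r θ)))]
  rwa [sub_neg_eq_add, zero_add, abs_of_pos hπ] at this

lemma tendsto_semicircleIntegral {f : ℂ → ℂ}
    (h : Tendsto (semicircleAbsIntegral f) atTop (𝓝 0)) :
    Tendsto (semicircleIntegral f) atTop (𝓝 0) := by
  refine squeeze_zero_norm' ?_ h
  filter_upwards [eventually_gt_atTop 0] with r hr
  refine (intervalIntegral.norm_integral_le_integral_norm (by linarith [Real.pi_pos])).trans_eq ?_
  refine intervalIntegral.integral_congr fun θ _ => ?_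
  simp [abs_of_pos hr]

lemma norm_inv_sub_le_one {a z : ℂ} (h : ‖a‖ + 1 ≤ ‖z‖) : ‖(z - a)⁻¹‖ ≤ 1 := by
  rw [norm_inv]
  refine inv_le_one_of_one_le₀ ?_
  linarith [norm_sub_norm_le z a]

lemma semicircleIntegral_inv_sub_mul {B : ℂ → ℂ} (hB : IsRapidLower B) {a : ℂ} (ha : a.im < 0)
    {r : ℝ} (hr : ‖a‖ < r) : semicircleIntegral (fun z => (z - a)⁻¹ * B z) r =
      (∫ x in (-r)..r, ((x : ℂ) - a)⁻¹ * B x) + 2 * Real.pi * I * B a := by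
  have h := semicircle_sub_integral_cauchy B ha hr hB.cont hB.diff
  simp only [smul_eq_mul] at h
  rw [← h, semicircleIntegral]
  simp_rw [mul_comm (_ * B _)]
  ring

lemma semicircleIntegral_eq_integral {B : ℂ → ℂ} (hB : IsRapidLower B) {r : ℝ} (hr : 0 < r) :
    semicircleIntegral B r = ∫ x in (-r)..r, B x := by
  have h := semicircle_eq_integral B hr (hB.cont.mono fun z hz => hz.1)
    (hB.diff.mono fun z hz => hz.1)
  simp only [smul_eq_mul] at h
  rw [← h, semicircleIntegral]
  simp_rw [mul_comm (B _)]

/-- Cauchy's integral formula over the whole real line for the lower half-plane. -/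
lemma integral_inv_sub_mul {B : ℂ → ℂ} (hB : IsRapidLower B) {a : ℂ} (ha : a.im < 0) :
    ∫ x : ℝ, ((x : ℂ) - a)⁻¹ * B x = -(2 * Real.pi * I * B a) := by
  obtain ⟨C, hC⟩ := hB.decay 2
  have h1 : Tendsto (semicircleIntegral fun z => (z - a)⁻¹ * B z) atTop (𝓝 0) := by
    refine tendsto_semicircleIntegral (tendsto_semicircleAbsIntegral (C := C) (r₀ := ‖a‖ + 1)
      fun z hz hr => le_trans ?_ (hC z hz))
    rw [norm_mul]
    gcongr
    exact mul_le_of_le_one_left (norm_nonneg _) (norm_inv_sub_le_one hr)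
  have h2 : Tendsto (fun r : ℝ => ∫ x in (-r)..r, ((x : ℂ) - a)⁻¹ * B x) atTop
      (𝓝 (∫ x : ℝ, ((x : ℂ) - a)⁻¹ * B x)) :=
    intervalIntegral_tendsto_integral (integrable_inv_sub_mul ha hB.integrable)
      tendsto_neg_atTop_atBot tendsto_id
  have h3 := h1.congr' (f₂ := fun r => (∫ x in (-r)..r, ((x : ℂ) - a)⁻¹ * B x) +
      2 * Real.pi * I * B a) (by
    filter_upwards [eventually_gt_atTop ‖a‖] with r hr using
      semicircleIntegral_inv_sub_mul hB ha hr)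
  have h4 := tendsto_nhds_unique h3 (h2.add_const _)
  exact eq_neg_of_add_eq_zero_left h4.symm

lemma IsRapidLower.mul_of_growth {B T : ℂ → ℂ} (hB : IsRapidLower B)
    (hc : ContinuousOn T {z | z.im ≤ 0}) (hd : DifferentiableOn ℂ T {z | z.im < 0})
    {C : ℝ} {m : ℕ} (hT : ∀ z : ℂ, z.im ≤ 0 → ‖T z‖ ≤ C * (1 + ‖z‖) ^ m) :
    IsRapidLower fun z => T z * B z := by
  refine ⟨hc.mul hB.cont, hd.mul hB.diff, fun n => ?_⟩
  obtain ⟨D, hD⟩ := hB.decay (n + m)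
  have hC0 : 0 ≤ C := by
    have := (norm_nonneg _).trans (hT 0 (by simp))
    simpa using this
  refine ⟨C * D, fun z hz => ?_⟩
  calc (1 + ‖z‖) ^ n * ‖T z * B z‖ = (1 + ‖z‖) ^ n * (‖T z‖ * ‖B z‖) := by rw [norm_mul]
    _ ≤ (1 + ‖z‖) ^ n * (C * (1 + ‖z‖) ^ m * ‖B z‖) := by
        gcongr
        exact hT z hz
    _ = C * ((1 + ‖z‖) ^ (n + m) * ‖B z‖) := by ring
    _ ≤ C * D := mul_le_mul_of_nonneg_left (hD z hz) hC0

end LineIntegral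

/-! ### Gamow kets. -/

section Gamow

variable {K : Type*} [NormedAddCommGroup K] [InnerProductSpace ℂ K]

lemma integrable_gamow {a : ℂ} (ha : a.im < 0) (k : K) (ψ : 𝓢(ℝ, K)) :
    Integrable fun s : ℝ => inner ℂ (ψ s) k * (1 / ((s : ℂ) - a)) := by
  have h : Integrable fun s : ℝ => inner ℂ (ψ s) k := by
    refine (ψ.integrable.norm.mul_const ‖k‖).mono'
      (ψ.continuous.inner continuous_const).aestronglyMeasurable
      (Eventually.of_forall fun s => norm_inner_le_norm _ _)
  refine (integrable_inv_sub_mul ha h).congr (Eventually.of_forall fun s => ?_)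
  simp only [one_div]
  ring

/-- The real line closed in the lower half-plane runs clockwise, so Cauchy's formula yields `-2πi`;
the prefactor `i / 2π` normalises this to `1`. -/
lemma gamowKet_eq [CompleteSpace K] {a : ℂ} (ha : a.im < 0) (k : K) (ψ : outSpace K)
    {Ψ : ℂ → K} (hΨ : IsHardyExtension (Ioi 0) (ψ : 𝓢(ℝ, K)) Ψ) :
    gamowKet a k ψ = inner ℂ (Ψ (conj a)) k := by
  have h := integral_inv_sub_mul (isRapidLower_braKet_const hΨ k) ha
  have e : ∀ s : ℝ, inner ℂ ((ψ : 𝓢(ℝ, K)) s) k * (1 / ((s : ℂ) - a)) =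
      ((s : ℂ) - a)⁻¹ * braKet Ψ (fun _ => k) s := fun s => by
    rw [braKet, conj_ofReal, hΨ.on_real, one_div, mul_comm]
  rw [gamowKet]
  simp_rw [e]
  rw [h, braKet]
  have hπ : (Real.pi : ℂ) ≠ 0 := ofReal_ne_zero.2 Real.pi_ne_zero
  field_simp
  linear_combination (-inner ℂ (Ψ (conj a)) k) * I_sq

/-- Cauchy's formula for the bracket with the in-state evaluates it at the pole, where linearity in
the second slot produces the factor `c` that is divided out. -/
lemma gamowKet_eq_integral [CompleteSpace K] {a : ℂ} (ha : a.im < 0) (k : K) (ψ : outSpace K)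
    {Ψ Φ : ℂ → K} {φ : 𝓢(ℝ, K)} {c : ℂ} (hΨ : IsHardyExtension (Ioi 0) (ψ : 𝓢(ℝ, K)) Ψ)
    (hΦ : IsHardyExtension (Iio 0) φ Φ) (hc : c ≠ 0) (hk : Φ a = c • k) :
    gamowKet a k ψ = I / (2 * (Real.pi : ℂ)) *
      ∫ s : ℝ, 1 / ((s : ℂ) - a) * (inner ℂ ((ψ : 𝓢(ℝ, K)) s) (φ s) / c) := by
  have h := integral_inv_sub_mul (isRapidLower_braKet hΨ hΦ) ha
  have e : ∀ s : ℝ, 1 / ((s : ℂ) - a) * (inner ℂ ((ψ : 𝓢(ℝ, K)) s) (φ s) / c) =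
      (((s : ℂ) - a)⁻¹ * braKet Ψ Φ s) / c := fun s => by
    rw [braKet_ofReal hΨ hΦ, one_div, mul_div_assoc]
  rw [gamowKet_eq ha k ψ hΨ]
  simp_rw [e]
  rw [integral_div, h, braKet, hk, inner_smul_right]
  have hπ : (Real.pi : ℂ) ≠ 0 := ofReal_ne_zero.2 Real.pi_ne_zero
  field_simp
  linear_combination (inner ℂ (Ψ (conj a)) k) * I_sq

/-- The Gamow ket as a continuous antilinear functional. -/
lemma exists_gamowKet_clm {a : ℂ} (ha : a.im < 0) (k : K) :
    ∃ G : outSpace K →SL[starRingEnd ℂ] ℂ, ∀ ψ, G ψ = gamowKet a k ψ := by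
  have hπ := Real.pi_pos
  let G : outSpace K →ₛₗ[starRingEnd ℂ] ℂ :=
    { toFun := gamowKet a k
      map_add' := fun ψ χ => by
        simp only [gamowKet, Submodule.coe_add, add_apply, inner_add_left, add_mul]
        rw [integral_add (integrable_gamow ha k _) (integrable_gamow ha k _), mul_add]
      map_smul' := fun c ψ => by
        simp only [gamowKet, Submodule.coe_smul, smul_apply, inner_smul_left, mul_assoc]
        rw [integral_const_mul, smul_eq_mul]
        ring }
  -- The kernel is at most `1 / |im a|` on the real line, so the functional is controlled by the
  -- `L¹` norm, which is continuous in the Schwartz topology. The prefactor `1 / 2π` is weakened to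
  -- `1`.
  have hbound : ∀ ψ : outSpace K, ‖G ψ‖ ≤ (-a.im)⁻¹ * ‖k‖ *
      ‖SchwartzMap.toLpCLM ℂ K 1 (volume : Measure ℝ) (ψ : 𝓢(ℝ, K))‖ := by
    intro ψ
    have hL : ‖SchwartzMap.toLpCLM ℂ K 1 (volume : Measure ℝ) (ψ : 𝓢(ℝ, K))‖ =
        ∫ s : ℝ, ‖(ψ : 𝓢(ℝ, K)) s‖ := by
      rw [SchwartzMap.toLpCLM_apply, L1.norm_eq_integral_norm]
      refine integral_congr_ae ?_
      filter_upwards [SchwartzMap.coeFn_toLp (ψ : 𝓢(ℝ, K)) 1 (volume : Measure ℝ)] with s hs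
      rw [hs]
    have h1 : ‖∫ s : ℝ, inner ℂ ((ψ : 𝓢(ℝ, K)) s) k * (1 / ((s : ℂ) - a))‖ ≤
        ∫ s : ℝ, (-a.im)⁻¹ * ‖k‖ * ‖(ψ : 𝓢(ℝ, K)) s‖ := by
      refine norm_integral_le_of_norm_le ((ψ : 𝓢(ℝ, K)).integrable.norm.const_mul _)
        (Eventually.of_forall fun s => ?_)
      rw [norm_mul, one_div]
      have e1 := norm_inv_ofReal_sub_le ha s
      have e2 := norm_inner_le_norm (𝕜 := ℂ) ((ψ : 𝓢(ℝ, K)) s) k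
      have := mul_le_mul e2 e1 (norm_nonneg _) (by positivity)
      linarith
    rw [integral_const_mul, ← hL] at h1
    change ‖I / (2 * (Real.pi : ℂ)) * _‖ ≤ _
    rw [norm_mul]
    refine le_trans (mul_le_of_le_one_left (norm_nonneg _) ?_) h1
    rw [norm_div, norm_I, norm_mul, norm_real, Real.norm_of_nonneg hπ.le, Complex.norm_ofNat]
    rw [div_le_one (by positivity)]
    linarith [Real.pi_gt_three]
  refine ⟨⟨G, ?_⟩, fun ψ => rfl⟩
  refine continuous_of_continuousAt_zero G ?_
  rw [ContinuousAt, map_zero]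
  refine squeeze_zero_norm hbound ?_
  have hc : Continuous fun ψ : outSpace K => (-a.im)⁻¹ * ‖k‖ *
      ‖SchwartzMap.toLpCLM ℂ K 1 (volume : Measure ℝ) (ψ : 𝓢(ℝ, K))‖ :=
    continuous_const.mul
      ((SchwartzMap.toLpCLM ℂ K 1 (volume : Measure ℝ)).continuous.comp continuous_subtype_val).norm
  have := hc.tendsto 0
  simp only [ZeroMemClass.coe_zero, map_zero, norm_zero, mul_zero] at this
  exact this

end Gamow

/-! ### The second sheet and the regular part of the S-matrix. -/

section SecondSheet

lemma rootII_sq (s₀ : ℝ) (s : ℂ) : rootII s₀ s ^ 2 = s - s₀ := by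
  have h : ((conj (s - (s₀ : ℂ))) ^ (1 / 2 : ℂ)) ^ 2 = conj (s - (s₀ : ℂ)) := by
    have := cpow_nat_inv_pow (conj (s - (s₀ : ℂ))) (n := 2) two_ne_zero
    rwa [Nat.cast_ofNat, ← one_div] at this
  rw [rootII, ← map_pow, h, conj_conj]

lemma rootII_injective (s₀ : ℝ) : Function.Injective (rootII s₀) := fun s t h => by
  have h1 := rootII_sq s₀ s
  rw [h, rootII_sq] at h1
  exact (sub_left_injective h1).symm

lemma rootII_quadrant {s₀ : ℝ} {s : ℂ} (hs : s.im ≤ 0) :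
    0 ≤ (rootII s₀ s).re ∧ (rootII s₀ s).im ≤ 0 := by
  set u := conj (s - (s₀ : ℂ)) with hu
  have him : 0 ≤ u.im := by simpa [hu] using hs
  rw [rootII, conj_re, conj_im, ← hu]
  rcases eq_or_ne u 0 with h | h
  · rw [h, zero_cpow (by norm_num)]
    simp
  · rw [cpow_def_of_ne_zero h]
    have ha0 := arg_nonneg_iff.2 him
    have haπ := arg_le_pi u
    have e : (log u * (1 / 2)).im = u.arg / 2 := by
      rw [show log u * (1 / 2) = log u / (2 : ℝ) by push_cast; ring, div_ofReal_im, log_im]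
    rw [exp_re, exp_im, e]
    refine ⟨mul_nonneg (Real.exp_pos _).le (Real.cos_nonneg_of_mem_Icc ⟨?_, ?_⟩),
      neg_nonpos.2 (mul_nonneg (Real.exp_pos _).le (Real.sin_nonneg_of_nonneg_of_le_pi ?_ ?_))⟩ <;>
      linarith

/-- After conjugation only the closed upper half-plane matters, and there the principal logarithm is
continuous up to the negative axis. At the branch point continuity comes from the exponent having
positive real part. -/
lemma continuousOn_rootII (s₀ : ℝ) : ContinuousOn (rootII s₀) {s | s.im ≤ 0} := by
  have h : ContinuousOn (fun u : ℂ => u ^ (1 / 2 : ℂ)) {u | 0 ≤ u.im} := by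
    intro u hu
    have hu' : 0 ≤ u.im := hu
    by_cases hc : 0 ≤ u.re ∨ u.im ≠ 0
    · exact (continuousAt_cpow_const_of_re_pos hc (by norm_num)).continuousWithinAt
    · push Not at hc
      have hne : u ≠ 0 := fun h => by
        rw [h] at hc
        simp at hc
      have hl := continuousWithinAt_log_of_re_neg_of_im_zero hc.1 hc.2
      have h1 : ContinuousWithinAt (fun v => exp (log v * (1 / 2))) {u : ℂ | 0 ≤ u.im} u :=
        continuous_exp.continuousAt.comp_continuousWithinAt (hl.mul continuousWithinAt_const)
      refine h1.congr_of_eventuallyEq ?_ (cpow_def_of_ne_zero hne _)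
      filter_upwards [mem_nhdsWithin_of_mem_nhds (isOpen_ne.mem_nhds hne)] with v hv
      exact cpow_def_of_ne_zero hv _
  refine continuous_conj.comp_continuousOn (h.comp (by fun_prop) fun s hs => ?_)
  change 0 ≤ (conj (s - (s₀ : ℂ))).im
  have hs' : s.im ≤ 0 := hs
  simpa using hs'

/-- Off the real axis the principal power commutes with conjugation, so the two conjugations cancel
and the principal root of `s - s₀` remains. -/
lemma differentiableAt_rootII {s₀ : ℝ} {s : ℂ} (hs : s.im < 0) :
    DifferentiableAt ℂ (rootII s₀) s := by
  have him : ∀ z : ℂ, (z - (s₀ : ℂ)).im = z.im := fun z => by simp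
  have h1 : DifferentiableAt ℂ (fun z : ℂ => (z - (s₀ : ℂ)) ^ (1 / 2 : ℂ)) s := by
    refine DifferentiableAt.cpow_const (by fun_prop) (Or.inr ?_)
    rw [him]
    exact hs.ne
  refine h1.congr_of_eventuallyEq ?_
  filter_upwards [(isOpen_lt continuous_im continuous_const).mem_nhds hs] with z hz
  have harg : (z - (s₀ : ℂ)).arg ≠ Real.pi := fun h => by
    have := arg_eq_pi_iff.1 h
    rw [him] at this
    exact (ne_of_lt hz) this.2
  have h2 : conj (1 / 2 : ℂ) = 1 / 2 := by rw [map_div₀, map_one, map_ofNat]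
  rw [rootII, conj_cpow _ _ harg, h2, conj_conj]

lemma rootII_ofReal {s₀ s : ℝ} (hs : s₀ ≤ s) : rootII s₀ s = (Real.sqrt (s - s₀) : ℝ) := by
  have h : (1 / 2 : ℂ) = ((1 / 2 : ℝ) : ℂ) := by push_cast; rfl
  rw [rootII, ← ofReal_sub, conj_ofReal, h, ← ofReal_cpow (by linarith), conj_ofReal,
    Real.sqrt_eq_rpow]

lemma differentiableAt_inv_sub {a z : ℂ} (h : z ≠ a) :
    DifferentiableAt ℂ (fun w => (w - a)⁻¹) z :=
  DifferentiableAt.inv (by fun_prop) (sub_ne_zero.2 h)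

variable {s₀ : ℝ} {N : ℕ} {sR R : Fin N → ℂ} {S : ℂ → ℂ}

lemma IsPartialSMatrix.analyticAt_rootII (hS : IsPartialSMatrix s₀ sR R S) {s : ℂ} (hs : s.im ≤ 0)
    (hne : ∀ i, s ≠ sR i) : AnalyticAt ℂ S (rootII s₀ s) :=
  hS.analytic_second _ (rootII_quadrant hs).1 (rootII_quadrant hs).2
    fun i h => hne i (rootII_injective s₀ h)

lemma exists_norm_eval_le (P : Polynomial ℂ) :
    ∃ C : ℝ, 0 ≤ C ∧ ∀ s : ℂ, ‖P.eval s‖ ≤ C * (1 + ‖s‖) ^ P.natDegree := by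
  refine ⟨∑ k ∈ Finset.range (P.natDegree + 1), ‖P.coeff k‖, by positivity, fun s => ?_⟩
  rw [Polynomial.eval_eq_sum_range, Finset.sum_mul]
  refine norm_sum_le_of_le _ fun k hk => ?_
  rw [norm_mul, norm_pow]
  have hk' : k ≤ P.natDegree := by
    rw [Finset.mem_range] at hk
    omega
  gcongr
  calc ‖s‖ ^ k ≤ (1 + ‖s‖) ^ k := by gcongr; linarith
    _ ≤ (1 + ‖s‖) ^ P.natDegree := pow_le_pow_right₀ (by linarith [norm_nonneg s]) hk'

/-- Splitting off the resonance poles on the lower half of the second sheet. -/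
lemma IsPartialSMatrix.exists_regular_part (hS : IsPartialSMatrix s₀ sR R S) :
    ∃ T : ℂ → ℂ, ContinuousOn T {z | z.im ≤ 0} ∧ DifferentiableOn ℂ T {z | z.im < 0} ∧
      (∃ (C : ℝ) (m : ℕ), ∀ z : ℂ, z.im ≤ 0 → ‖T z‖ ≤ C * (1 + ‖z‖) ^ m) ∧
      ∀ z : ℂ, (∀ i, z ≠ sR i) → S (rootII s₀ z) = T z + ∑ i, R i * (z - sR i)⁻¹ := by
  classical
  have hopen : IsOpen {z : ℂ | z.im < 0} := isOpen_lt continuous_im continuous_const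
  choose hR g hg hSg using hS.simple_pole
  -- At a pole the value of `S` carries no information, so the regular part is defined there by the
  -- local analytic remainder `g` minus the other kernels. Distinctness of the poles makes the
  -- chosen index the right one.
  set T : ℂ → ℂ := fun z => if h : ∃ i, z = sR i then
      g h.choose z - ∑ j ∈ Finset.univ.erase h.choose, R j * (z - sR j)⁻¹
    else S (rootII s₀ z) - ∑ i, R i * (z - sR i)⁻¹ with hT
  have hTne : ∀ z : ℂ, (∀ i, z ≠ sR i) → T z = S (rootII s₀ z) - ∑ i, R i * (z - sR i)⁻¹ := by
    intro z hz
    have : ¬ ∃ i, z = sR i := fun ⟨i, hi⟩ => hz i hi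
    simp only [hT, dif_neg this]
  have hTpole : ∀ i, T (sR i) =
      g i (sR i) - ∑ j ∈ Finset.univ.erase i, R j * (sR i - sR j)⁻¹ := by
    intro i
    have h : ∃ j, sR i = sR j := ⟨i, rfl⟩
    have hi : h.choose = i := (hS.pole_injective h.choose_spec).symm
    simp only [hT, dif_pos h]
    rw [hi]
  have hTat : ∀ i, DifferentiableAt ℂ T (sR i) := by
    intro i
    have hd : DifferentiableAt ℂ
        (fun z => g i z - ∑ j ∈ Finset.univ.erase i, R j * (z - sR j)⁻¹) (sR i) := by
      refine (hg i).differentiableAt.sub (DifferentiableAt.fun_sum fun j hj => ?_)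
      exact (differentiableAt_inv_sub fun h =>
        (Finset.ne_of_mem_erase hj) (hS.pole_injective h).symm).const_mul _
    refine hd.congr_of_eventuallyEq ?_
    have hother : ∀ᶠ z in 𝓝 (sR i), ∀ j, j ≠ i → z ≠ sR j := by
      rw [eventually_all]
      intro j
      by_cases hj : j = i
      · exact Eventually.of_forall fun z h => (h hj).elim
      · have : sR i ≠ sR j := fun h => hj (hS.pole_injective h).symm
        filter_upwards [isOpen_ne.mem_nhds this] with z hz _ using hz
    have hSi := eventually_nhdsWithin_iff.1 (hSg i)
    filter_upwards [hother, hSi] with z h1 h2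
    by_cases hz : z = sR i
    · rw [hz, hTpole]
    · have hz' : ∀ j, z ≠ sR j := fun j => by
        by_cases hj : j = i
        · rwa [hj]
        · exact h1 j hj
      rw [hTne z hz', h2 hz, ← Finset.add_sum_erase _ _ (Finset.mem_univ i)]
      ring
  have hpoles : ∀ z : ℂ, (∀ i, z ≠ sR i) → ∀ᶠ w in 𝓝 z, ∀ i, w ≠ sR i := fun z hz => by
    rw [eventually_all]
    exact fun i => isOpen_ne.mem_nhds (hz i)
  have hdiff : DifferentiableOn ℂ T {z | z.im < 0} := by
    intro z hz
    refine DifferentiableAt.differentiableWithinAt ?_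
    by_cases h : ∃ i, z = sR i
    · obtain ⟨i, rfl⟩ := h
      exact hTat i
    · push Not at h
      have h1 : DifferentiableAt ℂ (fun z => S (rootII s₀ z) - ∑ i, R i * (z - sR i)⁻¹) z := by
        refine DifferentiableAt.sub ?_ (DifferentiableAt.fun_sum fun j _ => ?_)
        · exact (hS.analyticAt_rootII (le_of_lt hz) h).differentiableAt.comp z
            (differentiableAt_rootII hz)
        · exact (differentiableAt_inv_sub (h j)).const_mul _
      refine h1.congr_of_eventuallyEq ?_
      filter_upwards [hpoles z h] with w hw using hTne w hw
  have hcont : ContinuousOn T {z | z.im ≤ 0} := by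
    intro z hz
    by_cases h : ∃ i, z = sR i
    · obtain ⟨i, rfl⟩ := h
      exact (hTat i).continuousAt.continuousWithinAt
    · push Not at h
      have h1 : ContinuousWithinAt (fun z => S (rootII s₀ z) - ∑ i, R i * (z - sR i)⁻¹)
          {z | z.im ≤ 0} z := by
        refine ContinuousWithinAt.sub ?_ (ContinuousAt.continuousWithinAt
          (DifferentiableAt.fun_sum fun j _ => ?_ : DifferentiableAt ℂ _ z).continuousAt)
        · exact ((hS.analyticAt_rootII hz h).continuousAt).comp_continuousWithinAt
            (continuousOn_rootII s₀ z hz)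
        · exact (differentiableAt_inv_sub (h j)).const_mul _
      refine h1.congr_of_eventuallyEq ?_ (hTne z h)
      filter_upwards [mem_nhdsWithin_of_mem_nhds (hpoles z h)] with w hw using hTne w hw
  refine ⟨T, hcont, hdiff, ?_, fun z hz => by rw [hTne z hz]; ring⟩
  obtain ⟨P, r, hP⟩ := hS.poly_bound
  obtain ⟨C, hC0, hC⟩ := exists_norm_eval_le P
  set A : ℝ := ∑ i, ‖R i‖ with hA
  have hA0 : 0 ≤ A := by positivity
  -- Beyond this radius the polynomial bound holds and every pole is at distance at least `1`, so
  -- each kernel has modulus at most `1`. Within it compactness bounds `T`.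
  set ρ : ℝ := max r (∑ i, ‖sR i‖ + 1) with hρ
  have hcpt : IsCompact {z : ℂ | z.im ≤ 0 ∧ ‖z‖ ≤ ρ} := by
    have : {z : ℂ | z.im ≤ 0 ∧ ‖z‖ ≤ ρ} = Metric.closedBall 0 ρ ∩ {z | z.im ≤ 0} := by
      ext z; simp [and_comm]
    rw [this]
    exact (isCompact_closedBall _ _).inter_right (isClosed_le continuous_im continuous_const)
  obtain ⟨M, hM⟩ := hcpt.exists_bound_of_continuousOn (hcont.mono fun z hz => hz.1)
  refine ⟨C + A + |M|, P.natDegree, fun z hz => ?_⟩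
  have h1 : 1 ≤ (1 + ‖z‖) ^ P.natDegree := one_le_pow₀ (by linarith [norm_nonneg z])
  rcases le_total ‖z‖ ρ with h | h
  · calc ‖T z‖ ≤ |M| := (hM z ⟨hz, h⟩).trans (le_abs_self M)
      _ ≤ |M| * (1 + ‖z‖) ^ P.natDegree := le_mul_of_one_le_right (abs_nonneg M) h1
      _ ≤ _ := by gcongr; linarith
  · have hsR : ∀ i, ‖sR i‖ + 1 ≤ ‖z‖ := fun i => by
      refine le_trans ?_ ((le_max_right _ _).trans h)
      gcongr
      exact Finset.single_le_sum (f := fun i => ‖sR i‖) (fun i _ => norm_nonneg _)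
        (Finset.mem_univ i)
    have hne : ∀ i, z ≠ sR i := fun i hi => by
      have := hsR i
      rw [hi] at this
      linarith
    rw [hTne z hne]
    have h2 : ‖∑ i, R i * (z - sR i)⁻¹‖ ≤ A := by
      refine norm_sum_le_of_le _ fun i _ => ?_
      rw [norm_mul]
      exact mul_le_of_le_one_right (norm_nonneg _) (norm_inv_sub_le_one (hsR i))
    calc ‖S (rootII s₀ z) - ∑ i, R i * (z - sR i)⁻¹‖
        ≤ ‖S (rootII s₀ z)‖ + ‖∑ i, R i * (z - sR i)⁻¹‖ := norm_sub_le _ _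
      _ ≤ C * (1 + ‖z‖) ^ P.natDegree + A * (1 + ‖z‖) ^ P.natDegree := by
          refine add_le_add ((hP z hz ((le_max_left _ _).trans h)).trans (hC z)) ?_
          exact h2.trans (le_mul_of_one_le_right hA0 h1)
      _ ≤ _ := by
          have : 0 ≤ |M| * (1 + ‖z‖) ^ P.natDegree := by positivity
          linarith

end SecondSheet

/-! ### Residue calculus for functions with a pole decomposition. -/

section PoleDecomposition

/-- `f` is the sum of a rapidly decreasing function and of Cauchy kernels times such a function
on the closed lower half-plane minus the poles. -/
structure HasPoleDecomposition {N : ℕ} (sR R : Fin N → ℂ) (H B f : ℂ → ℂ) : Prop where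
  regular : IsRapidLower H
  factor : IsRapidLower B
  eq_add : ∀ z : ℂ, (∀ i, z ≠ sR i) → f z = H z + ∑ i, R i * ((z - sR i)⁻¹ * B z)

variable {N : ℕ} {sR R : Fin N → ℂ} {H B f : ℂ → ℂ}

lemma circleIntegral_inv_sub_center_mul {g : ℂ → ℂ} {c : ℂ} {ρ : ℝ} (hρ : 0 < ρ)
    (hg : DifferentiableOn ℂ g (Metric.closedBall c ρ)) :
    (∮ z in C(c, ρ), (z - c)⁻¹ * g z) = 2 * Real.pi * I * g c := by
  have := hg.circleIntegral_sub_inv_smul (Metric.mem_ball_self hρ)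
  simpa only [smul_eq_mul] using this

lemma clockwiseIntegral_breitWigner {r c : ℂ} {ρ : ℝ} (hρ : 0 < ρ)
    (hB : DifferentiableOn ℂ B (Metric.closedBall c ρ)) :
    clockwiseIntegral (fun s => breitWigner r c s * B s) c ρ =
      -2 * (Real.pi : ℂ) * I * r * B c := by
  have e : (fun s => breitWigner r c s * B s) = fun s => (s - c)⁻¹ * (r * B s) := by
    ext s
    rw [breitWigner]
    ring
  rw [clockwiseIntegral, e, circleIntegral_inv_sub_center_mul hρ (hB.const_mul r)]
  ring

lemma ne_of_sphere {ρ : Fin N → ℝ} (hρ : IsAdmissibleRadii sR ρ) {i : Fin N} {z : ℂ}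
    (hz : z ∈ Metric.sphere (sR i) (ρ i)) (j : Fin N) : z ≠ sR j := by
  rintro rfl
  by_cases hj : j = i
  · subst hj
    rw [Metric.mem_sphere, dist_self] at hz
    exact (hρ j).1.ne hz
  · exact (hρ i).2.2 j hj (Metric.sphere_subset_closedBall hz)

/-- All terms except the `i`-th kernel are holomorphic on the closed disc and integrate to zero
around it. -/
lemma HasPoleDecomposition.clockwiseIntegral_eq (h : HasPoleDecomposition sR R H B f)
    {ρ : Fin N → ℝ} (hρ : IsAdmissibleRadii sR ρ) (i : Fin N) :
    clockwiseIntegral f (sR i) (ρ i) =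
      clockwiseIntegral (fun s => breitWigner (R i) (sR i) s * B s) (sR i) (ρ i) := by
  obtain ⟨h0, hsub, hother⟩ := hρ i
  have hBd : DifferentiableOn ℂ B (Metric.closedBall (sR i) (ρ i)) := h.factor.diff.mono hsub
  have hrest : DifferentiableOn ℂ (fun z => H z + ∑ j ∈ Finset.univ.erase i,
      R j * ((z - sR j)⁻¹ * B z)) (Metric.closedBall (sR i) (ρ i)) := by
    refine (h.regular.diff.mono hsub).add (DifferentiableOn.fun_sum fun j hj => ?_)
    refine DifferentiableOn.const_mul (DifferentiableOn.mul (fun z hz => ?_) hBd) _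
    refine (differentiableAt_inv_sub ?_).differentiableWithinAt
    rintro rfl
    exact hother j (Finset.ne_of_mem_erase hj) hz
  have h1 : (∮ z in C(sR i, ρ i), (H z + ∑ j ∈ Finset.univ.erase i,
      R j * ((z - sR j)⁻¹ * B z))) = 0 :=
    circleIntegral_eq_zero_of_differentiable_on_off_countable h0.le countable_empty
      hrest.continuousOn fun z hz => (hrest.differentiableAt
        (mem_of_superset (Metric.isOpen_ball.mem_nhds hz.1) Metric.ball_subset_closedBall))
  have hne : ∀ z ∈ Metric.sphere (sR i) (ρ i), ∀ j, z ≠ sR j := fun z hz => ne_of_sphere hρ hz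
  have c1 : CircleIntegrable (fun z => H z + ∑ j ∈ Finset.univ.erase i,
      R j * ((z - sR j)⁻¹ * B z)) (sR i) (ρ i) :=
    (hrest.continuousOn.mono Metric.sphere_subset_closedBall).circleIntegrable h0.le
  have c2 : CircleIntegrable (fun z => breitWigner (R i) (sR i) z * B z) (sR i) (ρ i) := by
    refine ContinuousOn.circleIntegrable h0.le (ContinuousOn.mul ?_
      (hBd.continuousOn.mono Metric.sphere_subset_closedBall))
    exact ContinuousOn.div (by fun_prop) (by fun_prop) fun z hz => sub_ne_zero.2 (hne z hz i)
  rw [clockwiseIntegral, clockwiseIntegral]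
  congr 1
  rw [← zero_add (∮ z in C(sR i, ρ i), breitWigner (R i) (sR i) z * B z), ← h1,
    ← circleIntegral.integral_add c1 c2]
  refine circleIntegral.integral_congr h0.le fun z hz => ?_
  rw [h.eq_add z (hne z hz), ← Finset.add_sum_erase _ _ (Finset.mem_univ i), breitWigner]
  ring

variable (him : ∀ i, (sR i).im < 0)
include him

lemma HasPoleDecomposition.eq_add_real (h : HasPoleDecomposition sR R H B f) (x : ℝ) :
    f x = H x + ∑ i, R i * (((x : ℂ) - sR i)⁻¹ * B x) :=
  h.eq_add x fun i hi => ofReal_sub_ne_zero (him i) x (sub_eq_zero.2 hi)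

lemma HasPoleDecomposition.integrable (h : HasPoleDecomposition sR R H B f) :
    Integrable fun x : ℝ => f x := by
  simp_rw [h.eq_add_real him]
  exact h.regular.integrable.add (integrable_finsetSum _ fun i _ =>
    (integrable_inv_sub_mul (him i) h.factor.integrable).const_mul _)

omit him in
lemma HasPoleDecomposition.continuousOn_circle (h : HasPoleDecomposition sR R H B f) {r : ℝ}
    (hr : 0 < r) (hsR : ∀ i, ‖sR i‖ < r) :
    ContinuousOn (fun θ => f (circleMap 0 r θ)) (uIcc (-Real.pi) 0) := by
  have hπ := Real.pi_pos
  have hmaps : MapsTo (circleMap 0 r) (uIcc (-Real.pi) 0) {z | z.im ≤ 0} := by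
    rw [uIcc_of_le (by linarith)]
    exact fun θ hθ => circleMap_im_nonpos hr.le hθ.1 hθ.2
  have hcm := (continuous_circleMap 0 r).continuousOn (s := uIcc (-Real.pi) 0)
  have hne : ∀ (θ : ℝ) i, circleMap 0 r θ ≠ sR i := fun θ i hi => by
    have := hsR i
    rw [← hi, norm_circleMap_zero, abs_of_pos hr] at this
    exact lt_irrefl _ this
  have e : (fun θ => f (circleMap 0 r θ)) = fun θ => H (circleMap 0 r θ) +
      ∑ i, R i * ((circleMap 0 r θ - sR i)⁻¹ * B (circleMap 0 r θ)) :=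
    funext fun θ => h.eq_add _ (hne θ)
  rw [e]
  refine (h.regular.cont.comp hcm hmaps).add (continuousOn_finsetSum _ fun i _ => ?_)
  refine continuousOn_const.mul (ContinuousOn.mul ?_ (h.factor.cont.comp hcm hmaps))
  exact (hcm.sub continuousOn_const).inv₀ fun θ _ => sub_ne_zero.2 (hne θ i)

/-- The residue theorem for a half-disc of large radius. -/
lemma HasPoleDecomposition.semicircleIntegral_eq (h : HasPoleDecomposition sR R H B f) {r : ℝ}
    (hr : 0 < r) (hsR : ∀ i, ‖sR i‖ < r) :
    semicircleIntegral f r =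
      (∫ x in (-r)..r, f x) + ∑ i, 2 * (Real.pi : ℂ) * I * R i * B (sR i) := by
  have hne : ∀ (θ : ℝ) i, circleMap 0 r θ ≠ sR i := fun θ i hi => by
    have := hsR i
    rw [← hi, norm_circleMap_zero, abs_of_pos hr] at this
    exact lt_irrefl _ this
  have hmI : Continuous fun θ : ℝ => circleMap 0 r θ * I :=
    (continuous_circleMap 0 r).mul continuous_const
  -- Each kernel term, and `H` alone, is itself a pole decomposition with one or no pole; this
  -- supplies continuity of the summands on the arc.
  have single : ∀ i, HasPoleDecomposition (fun _ : Fin 1 => sR i) (fun _ => 1) (fun _ => 0) B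
      (fun z => (z - sR i)⁻¹ * B z) := fun i =>
    ⟨⟨continuousOn_const, differentiableOn_const _, fun n => ⟨0, by simp⟩⟩, h.factor, by simp⟩
  have reg : HasPoleDecomposition (Fin.elim0 : Fin 0 → ℂ) Fin.elim0 H B H :=
    ⟨h.regular, h.factor, by simp⟩
  have i1 : IntervalIntegrable (fun θ => H (circleMap 0 r θ) * (circleMap 0 r θ * I)) volume
      (-Real.pi) 0 :=
    ((reg.continuousOn_circle hr fun i => i.elim0).mul hmI.continuousOn).intervalIntegrable
  have i2 : ∀ i, IntervalIntegrable (fun θ => R i * ((circleMap 0 r θ - sR i)⁻¹ *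
      B (circleMap 0 r θ) * (circleMap 0 r θ * I))) volume (-Real.pi) 0 := fun i =>
    (((single i).continuousOn_circle hr fun _ => hsR i).mul
      hmI.continuousOn).intervalIntegrable.const_mul _
  have e1 : semicircleIntegral f r = semicircleIntegral H r +
      ∑ i, R i * semicircleIntegral (fun z => (z - sR i)⁻¹ * B z) r := by
    simp only [semicircleIntegral]
    simp_rw [← intervalIntegral.integral_const_mul]
    rw [← intervalIntegral.integral_finsetSum fun i _ => i2 i,
      ← intervalIntegral.integral_add i1 (by
        simpa only [Finset.sum_fn] using IntervalIntegrable.sum Finset.univ fun i _ => i2 i)]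
    refine intervalIntegral.integral_congr fun θ _ => ?_
    simp only [h.eq_add _ (hne θ), add_mul, Finset.sum_mul, mul_assoc]
  have j1 : IntervalIntegrable (fun x : ℝ => H x) volume (-r) r :=
    h.regular.integrable.intervalIntegrable
  have j2 : ∀ i, IntervalIntegrable (fun x : ℝ => R i * (((x : ℂ) - sR i)⁻¹ * B x)) volume
      (-r) r := fun i =>
    ((integrable_inv_sub_mul (him i) h.factor.integrable).const_mul _).intervalIntegrable
  have e2 : (∫ x in (-r)..r, f x) = (∫ x in (-r)..r, H x) +
      ∑ i, R i * ∫ x in (-r)..r, ((x : ℂ) - sR i)⁻¹ * B x := by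
    simp_rw [← intervalIntegral.integral_const_mul]
    rw [← intervalIntegral.integral_finsetSum fun i _ => j2 i,
      ← intervalIntegral.integral_add j1 (by
        simpa only [Finset.sum_fn] using IntervalIntegrable.sum Finset.univ fun i _ => j2 i)]
    refine intervalIntegral.integral_congr fun x _ => ?_
    exact h.eq_add_real him x
  rw [e1, e2, semicircleIntegral_eq_integral h.regular hr]
  simp_rw [fun i => semicircleIntegral_inv_sub_mul h.factor (him i) (hsR i), mul_add,
    Finset.sum_add_distrib]
  rw [add_assoc]
  congr 2
  refine Finset.sum_congr rfl fun i _ => ?_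
  ring

omit him in
lemma HasPoleDecomposition.tendsto_semicircleAbsIntegral
    (h : HasPoleDecomposition sR R H B f) : Tendsto (semicircleAbsIntegral f) atTop (𝓝 0) := by
  obtain ⟨C, hC⟩ := h.regular.decay 2
  obtain ⟨D, hD⟩ := h.factor.decay 2
  refine _root_.tendsto_semicircleAbsIntegral (C := C + ∑ i, ‖R i‖ * D)
    (r₀ := ∑ i, ‖sR i‖ + 1) fun z hz hr => ?_
  have hsR : ∀ i, ‖sR i‖ + 1 ≤ ‖z‖ := fun i => by
    refine le_trans ?_ hr
    gcongr
    exact Finset.single_le_sum (f := fun i => ‖sR i‖) (fun i _ => norm_nonneg _)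
      (Finset.mem_univ i)
  have hne : ∀ i, z ≠ sR i := fun i hi => by
    have := hsR i
    rw [hi] at this
    linarith
  rw [h.eq_add z hne]
  have h1 : (1 + ‖z‖) ^ 2 * ‖∑ i, R i * ((z - sR i)⁻¹ * B z)‖ ≤ ∑ i, ‖R i‖ * D := by
    calc (1 + ‖z‖) ^ 2 * ‖∑ i, R i * ((z - sR i)⁻¹ * B z)‖
        ≤ (1 + ‖z‖) ^ 2 * ∑ i, ‖R i‖ * ‖B z‖ := by
          gcongr
          refine norm_sum_le_of_le _ fun i _ => ?_
          rw [norm_mul, norm_mul]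
          gcongr
          exact mul_le_of_le_one_left (norm_nonneg _) (norm_inv_sub_le_one (hsR i))
      _ = ∑ i, ‖R i‖ * ((1 + ‖z‖) ^ 2 * ‖B z‖) := by
          rw [Finset.mul_sum]
          exact Finset.sum_congr rfl fun i _ => by ring
      _ ≤ _ := by
          gcongr
          exact hD z hz
  calc (1 + ‖z‖) ^ 2 * ‖H z + ∑ i, R i * ((z - sR i)⁻¹ * B z)‖
      ≤ (1 + ‖z‖) ^ 2 * (‖H z‖ + ‖∑ i, R i * ((z - sR i)⁻¹ * B z)‖) := by
        gcongr
        exact norm_add_le _ _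
    _ ≤ _ := by
        rw [mul_add]
        exact add_le_add (hC z hz) h1

/-- The residue theorem for the real line closed in the lower half-plane. -/
lemma HasPoleDecomposition.integral_eq (h : HasPoleDecomposition sR R H B f) :
    ∫ x : ℝ, f x = ∑ i, -2 * (Real.pi : ℂ) * I * R i * B (sR i) := by
  have h1 := tendsto_semicircleIntegral h.tendsto_semicircleAbsIntegral
  have h2 : Tendsto (fun r : ℝ => ∫ x in (-r)..r, f x) atTop (𝓝 (∫ x : ℝ, f x)) :=
    intervalIntegral_tendsto_integral (h.integrable him) tendsto_neg_atTop_atBot tendsto_id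
  have h3 := h1.congr' (f₂ := fun r => (∫ x in (-r)..r, f x) +
      ∑ i, 2 * (Real.pi : ℂ) * I * R i * B (sR i)) (by
    filter_upwards [eventually_gt_atTop 0, eventually_all.2 fun i => eventually_gt_atTop ‖sR i‖]
      with r hr0 hr using h.semicircleIntegral_eq him hr0 hr)
  have h4 := eq_neg_of_add_eq_zero_left (tendsto_nhds_unique h3 (h2.add_const _)).symm
  rw [h4, ← Finset.sum_neg_distrib]
  exact Finset.sum_congr rfl fun i _ => by ring

end PoleDecomposition

/-! ### Application to the S-matrix element. -/

section MatrixElement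

variable {K : Type*} [NormedAddCommGroup K] [InnerProductSpace ℂ K] {s₀ : ℝ} {N : ℕ}
  {sR R : Fin N → ℂ} {S : ℂ → ℂ} {ψ φ : 𝓢(ℝ, K)} {Ψ Φ : ℂ → K}

/-- The regular part of `S` grows polynomially and the bracket decays faster than any power, so
their product is still rapidly decreasing. -/
lemma IsPartialSMatrix.exists_poleDecomposition [CompleteSpace K]
    (hS : IsPartialSMatrix s₀ sR R S) (hΨ : IsHardyExtension (Ioi 0) ψ Ψ)
    (hΦ : IsHardyExtension (Iio 0) φ Φ) :
    ∃ H, HasPoleDecomposition sR R H (braKet Ψ Φ) (integrandII s₀ S Ψ Φ) := by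
  obtain ⟨T, hc, hd, ⟨C, m, hT⟩, hST⟩ := hS.exists_regular_part
  have hB := isRapidLower_braKet hΨ hΦ
  refine ⟨_, hB.mul_of_growth hc hd hT, hB, fun z hz => ?_⟩
  rw [integrandII, hST z hz, add_mul, Finset.sum_mul]
  simp_rw [mul_assoc]

lemma physicalIntegrand_eq (hΨ : IsHardyExtension (Ioi 0) ψ Ψ)
    (hΦ : IsHardyExtension (Iio 0) φ Φ) {s : ℝ} (hs : s₀ ≤ s) :
    physicalIntegrand s₀ S ψ φ s = integrandII s₀ S Ψ Φ s := by
  rw [physicalIntegrand, integrandII, rootII_ofReal hs, braKet_ofReal hΨ hΦ]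

end MatrixElement

theorem mainTheorem2 {K : Type*} [NormedAddCommGroup K] [InnerProductSpace ℂ K] [CompleteSpace K]
    (s₀ : ℝ) {N : ℕ} (sR R : Fin N → ℂ) (S : ℂ → ℂ) (hS : IsPartialSMatrix s₀ sR R S) :
    -- wave functions are determined by their values at the physical energies
    (Function.Injective fun (f : outSpace K) (s : Ici s₀) => (f : 𝓢(ℝ, K)) (s : ℝ)) ∧
    (Function.Injective fun (f : inSpace K) (s : Ici s₀) => (f : 𝓢(ℝ, K)) (s : ℝ)) ∧
    -- decomposition of the matrix element
    (∀ ψ ∈ outSpace K, ∀ φ ∈ inSpace K, ∀ Ψ Φ : ℂ → K,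
      IsHardyExtension (Ioi 0) ψ Ψ → IsHardyExtension (Iio 0) φ Φ →
      ∀ ρ : Fin N → ℝ, IsAdmissibleRadii sR ρ →
      -- the integrals over the half-axes converge
      IntegrableOn (physicalIntegrand s₀ S ψ φ) (Ici s₀) ∧
      IntegrableOn (fun s : ℝ => integrandII s₀ S Ψ Φ (s : ℂ)) (Iic s₀) ∧
      -- contour deformation, with a semicircle of any large radius
      (∀ r : ℝ, |s₀| < r → (∀ i, ‖sR i‖ < r) →
        IntervalIntegrable (fun θ => integrandII s₀ S Ψ Φ (circleMap 0 r θ)) volume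
          (-Real.pi) 0 ∧
        ∫ s in s₀..r, physicalIntegrand s₀ S ψ φ s =
          (∫ s in s₀..(-r), integrandII s₀ S Ψ Φ (s : ℂ)) +
          ∑ i, clockwiseIntegral (integrandII s₀ S Ψ Φ) (sR i) (ρ i) +
          semicircleIntegral (integrandII s₀ S Ψ Φ) r) ∧
      -- the infinite semicircle does not contribute
      Tendsto (semicircleAbsIntegral (integrandII s₀ S Ψ Φ)) atTop (𝓝 0) ∧
      -- background term plus one pole term for each resonance
      matrixElement s₀ S ψ φ = backgroundTerm s₀ S Ψ Φ +
        ∑ i, clockwiseIntegral (integrandII s₀ S Ψ Φ) (sR i) (ρ i) ∧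
      -- evaluation of the pole terms
      ∀ i,
        clockwiseIntegral (integrandII s₀ S Ψ Φ) (sR i) (ρ i) =
          clockwiseIntegral (fun s => breitWigner (R i) (sR i) s * braKet Ψ Φ s) (sR i) (ρ i) ∧
        clockwiseIntegral (fun s => breitWigner (R i) (sR i) s * braKet Ψ Φ s) (sR i) (ρ i) =
          -2 * (Real.pi : ℂ) * I * R i * braKet Ψ Φ (sR i) ∧
        Integrable (fun s : ℝ => breitWigner (R i) (sR i) (s : ℂ) * inner ℂ (ψ s) (φ s)) ∧
        -2 * (Real.pi : ℂ) * I * R i * braKet Ψ Φ (sR i) =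
          ∫ s : ℝ, breitWigner (R i) (sR i) (s : ℂ) * inner ℂ (ψ s) (φ s)) ∧
    -- the Gamow kets: continuous antilinear functionals on the space of out-observables
    (∀ (i : Fin N) (k : K),
      (∃ G : outSpace K →SL[starRingEnd ℂ] ℂ, ∀ ψ, G ψ = gamowKet (sR i) k ψ) ∧
      ∀ (ψ : outSpace K) (Ψ : ℂ → K), IsHardyExtension (Ioi 0) (ψ : 𝓢(ℝ, K)) Ψ →
        Integrable (fun s : ℝ => inner ℂ ((ψ : 𝓢(ℝ, K)) s) k * (1 / ((s : ℂ) - sR i))) ∧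
        gamowKet (sR i) k ψ = inner ℂ (Ψ (conj (sR i))) k ∧
        -- the representation that involves an in-state not vanishing at the pole
        ∀ φ ∈ inSpace K, ∀ (Φ : ℂ → K) (c : ℂ), IsHardyExtension (Iio 0) φ Φ → c ≠ 0 →
          Φ (sR i) = c • k →
          gamowKet (sR i) k ψ = I / (2 * (Real.pi : ℂ)) *
            ∫ s : ℝ, 1 / ((s : ℂ) - sR i) * (inner ℂ ((ψ : 𝓢(ℝ, K)) s) (φ s) / c)) := by
  refine ⟨outSpace_injective_restrict s₀, inSpace_injective_restrict s₀, ?_, ?_⟩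
  · intro ψ _ φ _ Ψ Φ hΨ hΦ ρ hρ
    obtain ⟨H, h⟩ := hS.exists_poleDecomposition hΨ hΦ
    have hint := h.integrable hS.pole_im
    have hphys : EqOn (fun s : ℝ => integrandII s₀ S Ψ Φ s) (physicalIntegrand s₀ S ψ φ)
        (Ici s₀) := fun s hs => (physicalIntegrand_eq hΨ hΦ hs).symm
    have hBW : ∀ i, clockwiseIntegral
        (fun s => breitWigner (R i) (sR i) s * braKet Ψ Φ s) (sR i) (ρ i) =
        -2 * (Real.pi : ℂ) * I * R i * braKet Ψ Φ (sR i) := fun i =>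
      clockwiseIntegral_breitWigner (hρ i).1 (h.factor.diff.mono (hρ i).2.1)
    have hcw : ∀ i, clockwiseIntegral (integrandII s₀ S Ψ Φ) (sR i) (ρ i) =
        -2 * (Real.pi : ℂ) * I * R i * braKet Ψ Φ (sR i) := fun i =>
      (h.clockwiseIntegral_eq hρ i).trans (hBW i)
    refine ⟨hint.integrableOn.congr_fun hphys measurableSet_Ici, hint.integrableOn, ?_,
      h.tendsto_semicircleAbsIntegral, ?_, fun i => ⟨h.clockwiseIntegral_eq hρ i, hBW i, ?_⟩⟩
    · intro r hr hsR
      have hr0 : 0 < r := (abs_nonneg s₀).trans_lt hr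
      have hs₀ : s₀ ≤ r := (le_abs_self s₀).trans hr.le
      refine ⟨(h.continuousOn_circle hr0 hsR).intervalIntegrable, ?_⟩
      have e1 : ∫ s in s₀..r, physicalIntegrand s₀ S ψ φ s =
          ∫ s in s₀..r, integrandII s₀ S Ψ Φ (s : ℂ) := by
        refine intervalIntegral.integral_congr fun s hs => ?_
        rw [uIcc_of_le hs₀] at hs
        exact physicalIntegrand_eq hΨ hΦ hs.1
      -- Splitting at `-r` leaves the integral over `[-r, r]`, which is the semicircle minus the
      -- residue sum; that negative sum is the sum of the clockwise circles.
      rw [e1, h.semicircleIntegral_eq hS.pole_im hr0 hsR,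
        ← intervalIntegral.integral_add_adjacent_intervals (b := -r)
          hint.intervalIntegrable hint.intervalIntegrable]
      simp_rw [hcw, neg_mul, Finset.sum_neg_distrib]
      ring
    · have e1 : matrixElement s₀ S ψ φ = ∫ s in Ioi s₀, integrandII s₀ S Ψ Φ (s : ℂ) := by
        rw [matrixElement, ← setIntegral_congr_fun measurableSet_Ici hphys,
          integral_Ici_eq_integral_Ioi]
      -- The integral over the whole line is the sum of pole terms. Removing the part below `s₀`
      -- gives the matrix element, and reversing its direction supplies the sign of the background
      -- term.
      have e2 := intervalIntegral.integral_Iic_add_Ioi (b := s₀) hint.integrableOn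
        hint.integrableOn
      rw [h.integral_eq hS.pole_im] at e2
      rw [e1, backgroundTerm]
      simp_rw [hcw]
      rw [← e2]
      ring
    · have e : ∀ s : ℝ, breitWigner (R i) (sR i) (s : ℂ) * inner ℂ (ψ s) (φ s) =
          R i * (((s : ℂ) - sR i)⁻¹ * braKet Ψ Φ s) := fun s => by
        rw [breitWigner, braKet_ofReal hΨ hΦ]
        ring
      simp_rw [e]
      refine ⟨(integrable_inv_sub_mul (hS.pole_im i) h.factor.integrable).const_mul _, ?_⟩
      rw [integral_const_mul, integral_inv_sub_mul h.factor (hS.pole_im i)]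
      ring
  · intro i k
    have ha := hS.pole_im i
    exact ⟨exists_gamowKet_clm ha k, fun ψ Ψ hΨ => ⟨integrable_gamow ha k _,
      gamowKet_eq ha k ψ hΨ, fun φ _ Φ c hΦ hc hk => gamowKet_eq_integral ha k ψ hΨ hΦ hc hk⟩⟩
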